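/- **Definitions.** A plane digraph is a finite directed multigraph $G$ embedded in the plane, given by the cyclic order of the edges around each vertex; $u\leadsto v$ means that $u$ can reach $v$ by a (possibly empty) directed path. Let $G$ be an acyclic plane digraph with a single source (a vertex that reaches all vertices), and let $G^\ast$ be its dual graph. For a face $f$, $\operatorname{bc}(f)$ is the smallest subgraph of $G$ that contains all vertices incident to $f$ and, with every vertex, all edges into it. An *s-t-decomposition* of $G$ is a rooted tree together with a bijection $x\mapsto f_x$ from its nodes to the faces of $G$ such that, with $S_x=\operatorname{bc}(f_x)$ for the root $x$ and $S_x=\operatorname{bc}(f_x)\cup S_y$ for a child $x$ of $y$, the following holds: if $x$ is a child of $y$, then $\{f_z : z \text{ is } x \text{ or a descendant of } x\}$ is the vertex set of the connected component of $f_x$ in $G^\ast$ minus the dual edges of $E[S_y]$. For a child $x$ of $y$, the *frame* $F_x$ is the boundary walk of the face of $S_y$ that is composed of these faces. It has *alternation number* $2a$ if it has $a$ source corners (between two outgoing edges) and $a$ target corners (between two ingoing edges). The *height* of the tree is the largest depth of a node, where the root has depth $0$. A *reachability labelling scheme* for a class of digraphs assigns to each vertex of each digraph in the class a bit string, its label,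 so that one fixed program, given only the labels of two vertices $u$ and $v$ of the same digraph, decides whether $u\leadsto v$. The program runs on a word RAM with words of $\Theta(\log n)$ bits, where $n$ is the number of vertices, whose unit-time operations are addition, subtraction, bitwise Boolean operations, shifts, comparisons with jumps, and array access (no multiplication or division); the labels are given as arrays of words. Here $\log n$ stands for $\lfloor\log_2 n\rfloor+1$. **Theorem.** For the acyclic single-source planar digraphs that have, for some plane embedding, an s-t-decomposition all of whose frames have alternation number $2$ or $4$, there is a reachability labelling scheme, with one program and absolute constants, such that every such digraph with $n$ vertices and such a decomposition of height $h$ has labels of $O((h+1)\log n)$ bits that the program evaluates in time $O(h+1)$. In particular, for every constant $h_0$, the digraphs that have such a decomposition of height at most $h_0$ have a reachability labelling scheme with labels of $O(\log n)$ bits and constant evaluation time. -/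

import Mathlib

universe u v t

namespace PlanarReach

/-! ### Digraphs and plane embeddings -/

/-- A directed multigraph with vertex type `V` and edge type `E`; the edge `e` is directed from
`src e` to `tgt e`. -/
structure MultiDigraph (V : Type u) (E : Type v) where
  src : E → V
  tgt : E → V

/-- Darts (half-edges): `(e, true)` is the end of `e` at its source, where `e` is outgoing, and
`(e, false)` is the end of `e` at its target, where `e` is ingoing. -/
abbrev Dart (E : Type v) : Type v := E × Bool

/-- The other half of the same edge. -/
def Dart.rev {E : Type v} : Equiv.Perm (Dart E) :=
  Equiv.prodCongr (Equiv.refl E) Equiv.boolNot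

namespace MultiDigraph

variable {V : Type u} {E : Type v} (G : MultiDigraph V E)

/-- There is an edge from `x` to `y`. -/
def Adj (x y : V) : Prop := ∃ e, G.src e = x ∧ G.tgt e = y

/-- `x` can reach `y` by a (possibly empty) directed path. -/
def Reach (x y : V) : Prop := Relation.ReflTransGen G.Adj x y

/-- No nonempty closed directed walk. -/
def Acyclic : Prop := ∀ x, ¬ Relation.TransGen G.Adj x x

/-- Some vertex reaches every vertex. -/
def SingleSource : Prop := ∃ s, ∀ x, G.Reach s x

/-- The vertex at which a dart is attached. -/
def base (d : Dart E) : V := if d.2 then G.src d.1 else G.tgt d.1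

/-- A subgraph (not necessarily induced). -/
@[ext]
structure Subgraph where
  verts : Set V
  edges : Set E
  src_mem : ∀ e ∈ edges, G.src e ∈ verts
  tgt_mem : ∀ e ∈ edges, G.tgt e ∈ verts

/-- Union of subgraphs. -/
def Subgraph.union {G : MultiDigraph V E} (H K : G.Subgraph) : G.Subgraph where
  verts := H.verts ∪ K.verts
  edges := H.edges ∪ K.edges
  src_mem e he := he.imp (H.src_mem e) (K.src_mem e)
  tgt_mem e he := he.imp (H.tgt_mem e) (K.tgt_mem e)

/-- `H` contains every edge of `G` whose head is a vertex of `H`. -/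
def Subgraph.BackwardClosed {G : MultiDigraph V E} (H : G.Subgraph) : Prop :=
  ∀ e, G.tgt e ∈ H.verts → e ∈ H.edges

/-- The backward closure of a set `A` of vertices: all vertices that reach `A`, with all edges
into them. `backwardClosure_least` says that it is the smallest backward closed subgraph that
contains `A`. -/
def backwardClosure (A : Set V) : G.Subgraph where
  verts := {x | ∃ a ∈ A, G.Reach x a}
  edges := {e | ∃ a ∈ A, G.Reach (G.tgt e) a}
  src_mem := fun e ⟨a, ha, h⟩ => ⟨a, ha, Relation.ReflTransGen.head ⟨e, rfl, rfl⟩ h⟩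
  tgt_mem := fun _ h => h

theorem backwardClosure_least (A : Set V) :
    (G.backwardClosure A).BackwardClosed ∧ A ⊆ (G.backwardClosure A).verts ∧
      ∀ H : G.Subgraph, H.BackwardClosed → A ⊆ H.verts →
        (G.backwardClosure A).verts ⊆ H.verts ∧ (G.backwardClosure A).edges ⊆ H.edges := by
  refine ⟨fun e he => he, fun a ha => ⟨a, ha, Relation.ReflTransGen.refl⟩, fun H hH hA => ?_⟩
  have key : (G.backwardClosure A).verts ⊆ H.verts := by
    rintro x ⟨a, ha, hx⟩
    induction hx using Relation.ReflTransGen.head_induction_on with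
    | refl => exact hA ha
    | head h _ ih =>
      obtain ⟨e, rfl, rfl⟩ := h
      exact H.src_mem e (hH e ih)
  exact ⟨key, fun e he => hH e (key he)⟩

end MultiDigraph

/-- An embedding of `G` in an oriented surface, given combinatorially: at each vertex a cyclic
permutation (say, the counterclockwise order) of the darts attached to it. The dart `d` also
stands for the corner between `d` and the next dart `rot d`. -/
structure Embedding {V : Type u} {E : Type v} (G : MultiDigraph V E) where
  rot : Equiv.Perm (Dart E)
  base_rot : ∀ d, G.base (rot d) = G.base d
  cyclic : ∀ d d', G.base d = G.base d' → rot.SameCycle d d'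

namespace Embedding

variable {V : Type u} {E : Type v} {G : MultiDigraph V E} (M : Embedding G)

/-- Walking around a face: from the corner between `d` and `rot d`, traverse the edge of `rot d`
and stop at the next corner of the same face. -/
def facePerm : Equiv.Perm (Dart E) := Dart.rev * M.rot

/-- Faces: the cycles of corners, together with one face for each isolated vertex (so that the
one-vertex graph has one face). -/
def Face : Type (max u v) :=
  Quotient (Equiv.Perm.SameCycle.setoid M.facePerm) ⊕ {x : V // ∀ d, G.base d ≠ x}

/-- The face of the corner `d`. It lies to the left of `d`, looking away from the vertex. -/
def faceOf (d : Dart E) : M.Face :=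
  Sum.inl (Quotient.mk (Equiv.Perm.SameCycle.setoid M.facePerm) d)

/-- The vertices incident to a face. -/
def faceVerts (f : M.Face) : Set V :=
  {x | (∃ d, G.base d = x ∧ M.faceOf d = f) ∨ ∃ h : ∀ d, G.base d ≠ x, f = Sum.inr ⟨x, h⟩}

/-- Genus zero, by Euler's formula `|V| - |E| + |F| = 2 c` with `c` the number of connected
components, each embedded in a sphere of its own. For connected `G` it says that the embedding is
an embedding in the sphere, or the plane, and that `Face` is the set of its faces. -/
def IsPlane : Prop :=
  Nat.card V + Nat.card M.Face = Nat.card E + 2 * Nat.card (Quot G.Adj)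

/-- The backward closure of a face. -/
def bc (f : M.Face) : G.Subgraph := G.backwardClosure (M.faceVerts f)

/-- Faces `f` and `g` are the two sides of an edge of `G` that is not in `H`: adjacency in the dual
graph after the deletion of the dual edges of `H`. -/
def DualAdj (H : G.Subgraph) (f g : M.Face) : Prop :=
  ∃ d : Dart E, d.1 ∉ H.edges ∧ M.faceOf d = f ∧ M.faceOf (Dart.rev d) = g

/-- The vertex set of the connected component of `f` in the dual graph minus the dual edges
of `H`. -/
def dualComponent (H : G.Subgraph) (f : M.Face) : Set M.Face :=
  {g | Relation.ReflTransGen (M.DualAdj H) f g}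

/-- `(d, d')` is a corner of the subgraph `H`: `d'` is the first dart of `H` after `d` in the
rotation around their common vertex (`d' = d` if `d` is the only dart of `H` there). -/
def IsCorner (H : G.Subgraph) (d d' : Dart E) : Prop :=
  d.1 ∈ H.edges ∧ d'.1 ∈ H.edges ∧
    ∃ k : ℕ, 0 < k ∧ (M.rot ^ k) d = d' ∧ ∀ j, 0 < j → j < k → ((M.rot ^ j) d).1 ∉ H.edges

/-- The source corners of `H` on the boundary of the face of `H` that is the union of the
faces in `K`: both darts are outgoing. -/
def sourceCorners (H : G.Subgraph) (K : Set M.Face) : Set (Dart E × Dart E) :=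
  {c | M.IsCorner H c.1 c.2 ∧ M.faceOf c.1 ∈ K ∧ c.1.2 = true ∧ c.2.2 = true}

/-- The target corners of `H` on the boundary of the face of `H` that is the union of the
faces in `K`: both darts are ingoing. -/
def targetCorners (H : G.Subgraph) (K : Set M.Face) : Set (Dart E × Dart E) :=
  {c | M.IsCorner H c.1 c.2 ∧ M.faceOf c.1 ∈ K ∧ c.1.2 = false ∧ c.2.2 = false}

/-- The boundary of the face of `H` that is the union of the faces in `K` has alternation
number `m`: there are `a` source corners and `a` target corners, and `m = 2 a`. -/
def HasAlternationNumber (H : G.Subgraph) (K : Set M.Face) (m : ℕ) : Prop :=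
  ∃ a, m = 2 * a ∧ (M.sourceCorners H K).ncard = a ∧ (M.targetCorners H K).ncard = a

end Embedding

/-! ### s-t-decompositions -/

/-- An s-t-decomposition of the embedded digraph `(G, M)` over the rooted tree `T`. In
`RootedTree` the order `x ≤ z` says that `x` is an ancestor of `z`, the root is `⊥`, and `y ⋖ x`
says that `x` is a child of `y`. -/
structure STDecomposition {V : Type u} {E : Type v} {G : MultiDigraph V E} (M : Embedding G)
    (T : RootedTree.{t}) where
  /-- the face `f_x` of a node -/
  face : T → M.Face
  /-- distinct nodes have distinct faces, and every face occurs -/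
  face_bijective : Function.Bijective face
  /-- the subgraph `S_x` of a node -/
  S : T → G.Subgraph
  S_root : S ⊥ = M.bc (face ⊥)
  S_child : ∀ y x : T, y ⋖ x → S x = (M.bc (face x)).union (S y)
  /-- the faces at the descendants of a child `x` of `y` form the component of `f_x` in the dual
  graph minus the dual edges of `S_y` -/
  dual_child : ∀ y x : T, y ⋖ x → face '' Set.Ici x = M.dualComponent (S y) (face x)

namespace STDecomposition

variable {V : Type u} {E : Type v} {G : MultiDigraph V E} {M : Embedding G} {T : RootedTree.{t}}
  (D : STDecomposition M T)

/-- The parent frame of the child `x` of `y`, which is the boundary of the face of `S_y` composed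
of the faces at the descendants of `x`, has alternation number `m`. -/
def FrameHasAlternationNumber (y x : T) (m : ℕ) : Prop :=
  M.HasAlternationNumber (D.S y) (D.face '' Set.Ici x) m

/-- Every frame has alternation number 2 or 4. -/
def AllFramesTwoOrFour : Prop :=
  ∀ y x : T, y ⋖ x → D.FrameHasAlternationNumber y x 2 ∨ D.FrameHasAlternationNumber y x 4

end STDecomposition

/-- The height of a rooted tree: the largest depth of a node, where the root has depth 0. -/
noncomputable def treeHeight (T : RootedTree.{t}) : ℕ∞ := ⨆ x : T, Order.height x

/-- `G` is an acyclic single-source planar digraph that, for some plane embedding, has an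
s-t-decomposition of height `h` all of whose frames have alternation number 2 or 4. -/
def AdmitsSTDecomposition {V : Type u} {E : Type v} (G : MultiDigraph V E) (h : ℕ) : Prop :=
  G.Acyclic ∧ G.SingleSource ∧ ∃ M : Embedding G, M.IsPlane ∧
    ∃ (T : RootedTree.{t}) (D : STDecomposition M T), treeHeight T = h ∧ D.AllFramesTwoOrFour

/-! ### The word RAM and labelling schemes -/

/-- Instructions of a word RAM without multiplication and division. Registers, addressed by
constants, and memory cells hold words; jump targets are positions in the program. -/
inductive Instr
  /-- `R[dst] := c` -/
  | const (dst c : ℕ)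
  | add (dst a b : ℕ)
  | sub (dst a b : ℕ)
  | and (dst a b : ℕ)
  | or (dst a b : ℕ)
  | xor (dst a b : ℕ)
  /-- `R[dst] := R[a] << R[b]` -/
  | shl (dst a b : ℕ)
  /-- `R[dst] := R[a] >> R[b]` -/
  | shr (dst a b : ℕ)
  /-- `R[dst] := Mem[R[addr]]` -/
  | load (dst addr : ℕ)
  /-- `Mem[R[addr]] := R[a]` -/
  | store (addr a : ℕ)
  /-- `R[dst] :=` word number `R[addr]` of the first input -/
  | inputFst (dst addr : ℕ)
  /-- `R[dst] :=` word number `R[addr]` of the second input -/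
  | inputSnd (dst addr : ℕ)
  | jump (target : ℕ)
  /-- jump to `target` if `R[a] < R[b]` -/
  | jumpLt (a b target : ℕ)
  /-- jump to `target` if `R[a] = R[b]` -/
  | jumpEq (a b target : ℕ)
  /-- stop with the output `answer` -/
  | halt (answer : Bool)

/-- A program. It is stuck, and never gives an output, once the program counter leaves it. -/
abbrev Program := List Instr

/-- Configurations: program counter, registers, memory. -/
structure Config where
  pc : ℕ
  reg : ℕ → ℕ
  mem : ℕ → ℕ

/-- All registers and memory cells are zero at the start. -/
def Config.initial : Config := ⟨0, fun _ => 0, fun _ => 0⟩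

/-- Word number `i` of a bit string that is cut into words of `w` bits, least significant bit
first; beyond the end of the string all bits are zero. -/
def wordAt (w : ℕ) (x : List Bool) (i : ℕ) : ℕ :=
  Nat.ofBits fun j : Fin w => x.getD (i * w + j) false

namespace Config

/-- Go to the next instruction after writing the word `a` (reduced to `w` bits) to a register. -/
def setReg (s : Config) (w dst a : ℕ) : Config :=
  { s with pc := s.pc + 1, reg := Function.update s.reg dst (a % 2 ^ w) }

/-- The program counter moves to `target` if `c` holds and to the next instruction otherwise. -/
def branch (s : Config) (c : Bool) (target : ℕ) : Config :=
  { s with pc := if c then target else s.pc + 1 }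

end Config

/-- The effect of one instruction for word length `w` and inputs `x`, `y`: a new configuration, or
the output if the machine stops. -/
def Instr.exec (w : ℕ) (x y : List Bool) (s : Config) : Instr → Config ⊕ Bool
  | const dst c => .inl (s.setReg w dst c)
  | add dst a b => .inl (s.setReg w dst (s.reg a + s.reg b))
  | sub dst a b => .inl (s.setReg w dst (s.reg a + 2 ^ w - s.reg b))
  | and dst a b => .inl (s.setReg w dst (s.reg a &&& s.reg b))
  | or dst a b => .inl (s.setReg w dst (s.reg a ||| s.reg b))
  | xor dst a b => .inl (s.setReg w dst (s.reg a ^^^ s.reg b))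
  | shl dst a b => .inl (s.setReg w dst (s.reg a <<< s.reg b))
  | shr dst a b => .inl (s.setReg w dst (s.reg a >>> s.reg b))
  | load dst addr => .inl (s.setReg w dst (s.mem (s.reg addr)))
  | store addr a =>
      .inl { s with pc := s.pc + 1, mem := Function.update s.mem (s.reg addr) (s.reg a) }
  | inputFst dst addr => .inl (s.setReg w dst (wordAt w x (s.reg addr)))
  | inputSnd dst addr => .inl (s.setReg w dst (wordAt w y (s.reg addr)))
  | jump target => .inl (s.branch true target)
  | jumpLt a b target => .inl (s.branch (decide (s.reg a < s.reg b)) target)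
  | jumpEq a b target => .inl (s.branch (decide (s.reg a = s.reg b)) target)
  | halt answer => .inr answer

/-- The output of `P`, started in the configuration `s`, if it stops within the given number of
instructions. Every instruction counts as one time step. -/
def Program.run (P : Program) (w : ℕ) (x y : List Bool) : ℕ → Config → Option Bool
  | 0, _ => none
  | k + 1, s =>
    match P[s.pc]? with
    | none => none
    | some i =>
      match i.exec w x y s with
      | .inl s' => Program.run P w x y k s'
      | .inr answer => some answer

/-- The bit strings `label x`, for the vertices `x` of `G`, have at most `bits` bits, and from the
labels of any two vertices `x` and `y` alone the program `P` decides on words of `w` bits within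
`time` steps whether `x` can reach `y`. -/
def IsReachabilityLabelling {V : Type u} {E : Type v} (G : MultiDigraph V E) (P : Program)
    (w : ℕ) (label : V → List Bool) (bits time : ℕ) : Prop :=
  (∀ x, (label x).length ≤ bits) ∧
    ∀ x y, ∃ answer : Bool, P.run w (label x) (label y) time Config.initial = some answer ∧
      (answer = true ↔ G.Reach x y)

/-- The number `⌊log₂ n⌋ + 1` of binary digits of the number `n` of vertices. -/
noncomputable def logSize (V : Type u) : ℕ := Nat.log 2 (Nat.card V) + 1

end PlanarReach

/-! Two facts are combined: reachability among the vertices that reach one common face is decided by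
three comparisons of ranks, and a frame can be crossed only by way of a bounded number of vertices.

One face `f` (`exists_face_order`). Let `s` be the source and `L` a walk from `s` to a vertex of `f`
that stays in `bc f` and always takes the first possible turn. A path from `u` to `w` either meets
`L`, which is decided by counting on a chain, or avoids the edges that enter `L` from outside.
Without these edges every vertex of `bc f` still has a leftmost and a rightmost walk from `s`,
ordered lexicographically by turns. Extending walks shows that `u` is at most `w` in both orders if
`u` reaches `w` there; conversely, planarity shows that `u` reaches `w` if it is at most `w` in both
orders (`reach_of_key_le`).

Algebra takes the place of the Jordan curve theorem. The difference of two walks with the same ends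
is a circulation, and by Euler's formula every circulation is the coboundary of a function on the
faces (`exists_face_potential`), which acts as a winding number. Contradictions arise from
evaluating it in two ways: by turning around vertices, and along a walk to `f` that meets no flow.

The tree. Each vertex `v` has a least node `c v`, with `v` in `S_x` iff `c v ≤ x`
(`exists_least_node`), and `c u ≤ c v` if `u` reaches `v`. For `c u < c v`, a path from `u` to `v`
leaves the subgraph of `c u` through a frame. With at most two source corners the frame consists of
at most four directed runs, and on each run the last vertex that reaches `v` can replace all others.
With `s` this gives five gates (`exists_frame_gates`); for `c u = c v` the vertex `v` itself is a
gate. So `u` reaches `v` iff `u` reaches a gate `w`; then `c w = c u`, and the face order of that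
node decides. A label stores 16 words for each relevant ancestor, and a query inspects a single
ancestor, hence takes constant time. -/

namespace PlanarReach

/-! ### Faces, and face potentials of circulations by Euler's formula -/

namespace Embedding

variable {V : Type u} {E : Type v} {G : MultiDigraph V E} (M : Embedding G)

instance [Finite V] [Finite E] : Finite M.Face :=
  inferInstanceAs (Finite (Quotient (Equiv.Perm.SameCycle.setoid M.facePerm) ⊕
    {x : V // ∀ d, G.base d ≠ x}))

@[simp] theorem base_out (e : E) : G.base (e, true) = G.src e := rfl

@[simp] theorem base_in (e : E) : G.base (e, false) = G.tgt e := rfl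

@[simp] theorem rev_mk (e : E) (b : Bool) : Dart.rev (e, b) = (e, !b) := rfl

theorem rev_rev (d : Dart E) : Dart.rev (Dart.rev d) = d := by
  obtain ⟨e, b⟩ := d
  simp

theorem base_symm (d : Dart E) : G.base (M.rot.symm d) = G.base d := by
  rw [← M.base_rot, Equiv.apply_symm_apply]

theorem base_pow (k : ℕ) (d : Dart E) : G.base ((M.rot ^ k) d) = G.base d := by
  induction k with
  | zero => rfl
  | succ k ih => rw [pow_succ', Equiv.Perm.mul_apply, M.base_rot, ih]

theorem faceOf_facePerm (d : Dart E) : M.faceOf (M.facePerm d) = M.faceOf d := by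
  unfold faceOf
  congr 1
  exact Quotient.sound (s := Equiv.Perm.SameCycle.setoid M.facePerm)
    (Equiv.Perm.sameCycle_apply_left.2 (Equiv.Perm.SameCycle.refl _ _))

/-- The corner just before `d` lies to the right of `d`, and the left side of the reversed dart is
the same side of the edge. This turns jumps across edges into jumps between consecutive corners. -/
theorem faceOf_symm (d : Dart E) : M.faceOf (M.rot.symm d) = M.faceOf (Dart.rev d) := by
  rw [← M.faceOf_facePerm]
  simp [facePerm]

/-- Two darts at the same vertex differ by a power of the rotation. -/
theorem exists_pow_eq [Finite E] {d d' : Dart E} (h : G.base d = G.base d') :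
    ∃ k : ℕ, (M.rot ^ k) d = d' := by
  obtain ⟨k, hk⟩ := (M.cyclic d d' h).exists_nat_pow_eq
  exact ⟨k, hk⟩

/-- A function that is invariant under the rotation at a vertex is constant there. -/
theorem const_at [Finite E] {α : Type*} (K : Dart E → α) {x : V}
    (h : ∀ d, G.base d = x → K (M.rot d) = K d) {d d' : Dart E} (hd : G.base d = x)
    (hd' : G.base d' = x) : K d = K d' := by
  obtain ⟨k, rfl⟩ := M.exists_pow_eq (hd.trans hd'.symm)
  clear hd'
  induction k with
  | zero => rfl
  | succ k ih => rw [pow_succ', Equiv.Perm.mul_apply, h _ ((M.base_pow k d).trans hd), ← ih]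

theorem exists_mem_faceVerts (f : M.Face) : ∃ x, x ∈ M.faceVerts f := by
  rcases f with q | ⟨x, hx⟩
  · obtain ⟨d, rfl⟩ := Quotient.exists_rep q
    exact ⟨G.base d, Or.inl ⟨d, rfl, rfl⟩⟩
  · exact ⟨x, Or.inr ⟨hx, rfl⟩⟩

theorem exists_face_mem (x : V) : ∃ f, x ∈ M.faceVerts f := by
  by_cases h : ∀ d, G.base d ≠ x
  · exact ⟨Sum.inr ⟨x, h⟩, Or.inr ⟨h, rfl⟩⟩
  · push Not at h
    obtain ⟨d, hd⟩ := h
    exact ⟨M.faceOf d, Or.inl ⟨d, hd, rfl⟩⟩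

/-- A function of the faces that has the same value on both sides of every edge is constant if
the digraph has a single source. -/
theorem face_const [Finite E] (hs : G.SingleSource) {α : Type*} (h : M.Face → α)
    (hh : ∀ d, h (M.faceOf d) = h (M.faceOf (Dart.rev d))) (f g : M.Face) : h f = h g := by
  have at_vertex : ∀ x f g, x ∈ M.faceVerts f → x ∈ M.faceVerts g → h f = h g := by
    rintro x f g (⟨d, hd, rfl⟩ | ⟨hx, rfl⟩) (⟨d', hd', rfl⟩ | ⟨hx', rfl⟩)
    · refine M.const_at (fun d => h (M.faceOf d)) (fun d _ => ?_) hd hd'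
      have := hh (M.rot d)
      rw [← M.faceOf_symm, Equiv.symm_apply_apply] at this
      exact this
    · exact absurd hd (hx' d)
    · exact absurd hd' (hx d')
    · rfl
  obtain ⟨s, hs⟩ := hs
  obtain ⟨g₀, hg₀⟩ := M.exists_face_mem s
  suffices H : ∀ x f, x ∈ M.faceVerts f → h f = h g₀ by
    obtain ⟨x, hx⟩ := M.exists_mem_faceVerts f
    obtain ⟨y, hy⟩ := M.exists_mem_faceVerts g
    rw [H x f hx, H y g hy]
  intro x
  induction hs x with
  | refl => exact fun f hf => at_vertex _ _ _ hf hg₀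
  | tail _ hyz ih =>
    obtain ⟨e, rfl, rfl⟩ := hyz
    intro f hf
    rw [← ih (M.faceOf (e, true)) (Or.inl ⟨(e, true), rfl, rfl⟩), hh]
    exact at_vertex _ _ _ hf (Or.inl ⟨(e, false), rfl, rfl⟩)

end Embedding

open Classical in
/-- The net flow out of the vertex `x`. -/
noncomputable def MultiDigraph.divergence {V : Type u} {E : Type v} [Fintype E]
    (G : MultiDigraph V E) (J : E → ℚ) (x : V) : ℚ :=
  ∑ e, ((if G.src e = x then J e else 0) - if G.tgt e = x then J e else 0)

open Classical in
/-- The incidence matrix. -/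
noncomputable def MultiDigraph.incidence {V : Type u} {E : Type v} (G : MultiDigraph V E) :
    Matrix V E ℚ := fun x e => (if G.src e = x then 1 else 0) - if G.tgt e = x then 1 else 0

namespace Embedding

variable {V : Type u} {E : Type v} {G : MultiDigraph V E} (M : Embedding G)

/-- The difference of a face potential between the two sides of an edge. -/
def faceCoboundary : (M.Face → ℚ) →ₗ[ℚ] (E → ℚ) where
  toFun h e := h (M.faceOf (e, true)) - h (M.faceOf (e, false))
  map_add' _ _ := by ext; simp; ring
  map_smul' _ _ := by ext; simp; ring

theorem incidence_mulVec [Fintype E] (J : E → ℚ) (x : V) :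
    (G.incidence.mulVec J) x = G.divergence J x := by
  unfold MultiDigraph.divergence Matrix.mulVec dotProduct MultiDigraph.incidence
  refine Finset.sum_congr rfl fun e _ => ?_
  by_cases h₁ : G.src e = x <;> by_cases h₂ : G.tgt e = x <;> simp [h₁, h₂]

/-- Around a vertex, the faces to the right of the darts are the faces to the left of them shifted
by one step of the rotation, so the two sums cancel. -/
theorem divergence_faceCoboundary [Fintype E] (h : M.Face → ℚ) (x : V) :
    G.divergence (M.faceCoboundary h) x = 0 := by
  classical
  have key : G.divergence (M.faceCoboundary h) x =
      (∑ d : Dart E, if G.base d = x then h (M.faceOf d) else 0) -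
        ∑ d : Dart E, if G.base d = x then h (M.faceOf (M.rot.symm d)) else 0 := by
    unfold MultiDigraph.divergence
    rw [← Finset.sum_sub_distrib, Fintype.sum_prod_type]
    refine Finset.sum_congr rfl fun e _ => ?_
    simp only [Fintype.sum_bool, base_out, base_in, faceOf_symm, rev_mk, faceCoboundary,
      LinearMap.coe_mk, AddHom.coe_mk, Bool.not_true, Bool.not_false]
    by_cases h₁ : G.src e = x <;> by_cases h₂ : G.tgt e = x <;> simp [h₁, h₂]
  rw [key, sub_eq_zero, ← Equiv.sum_comp M.rot.symm]
  refine Finset.sum_congr rfl fun d _ => ?_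
  rw [M.base_symm]

/-- In the plane every circulation is the difference of a face potential. -/
theorem exists_face_potential [Finite V] [Fintype E] (hs : G.SingleSource) (hM : M.IsPlane)
    (J : E → ℚ) (hJ : ∀ x, G.divergence J x = 0) : ∃ h, M.faceCoboundary h = J := by
  classical
  have := Fintype.ofFinite V
  have := Fintype.ofFinite M.Face
  have hquot : Nat.card (Quot G.Adj) = 1 := by
    obtain ⟨s, hs⟩ := hs
    rw [Nat.card_eq_one_iff_exists]
    refine ⟨Quot.mk _ s, fun q => ?_⟩
    obtain ⟨x, rfl⟩ := Quot.exists_rep q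
    induction hs x with
    | refl => rfl
    | tail _ h ih => rw [← ih, Quot.sound h]
  have hcard := hM
  unfold IsPlane at hcard
  rw [hquot, Nat.card_eq_fintype_card, Nat.card_eq_fintype_card, Nat.card_eq_fintype_card] at hcard
  have hker : Module.finrank ℚ (LinearMap.ker M.faceCoboundary) ≤ 1 := by
    refine (Submodule.finrank_mono (t := ℚ ∙ (fun _ => 1 : M.Face → ℚ)) ?_).trans
      (finrank_span_le_card (R := ℚ) ({fun _ => 1} : Set (M.Face → ℚ)) |>.trans (by simp))
    intro h hh
    rw [LinearMap.mem_ker] at hh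
    obtain ⟨x, hx⟩ : ∃ x : V, True := ⟨hs.choose, trivial⟩
    obtain ⟨g, -⟩ := M.exists_face_mem x
    refine Submodule.mem_span_singleton.2 ⟨h g, ?_⟩
    ext f
    simp only [Pi.smul_apply, smul_eq_mul, mul_one]
    refine M.face_const hs h (fun d => ?_) g f
    obtain ⟨e, b⟩ := d
    have := congrFun hh e
    simp only [faceCoboundary, LinearMap.coe_mk, AddHom.coe_mk, Pi.zero_apply, sub_eq_zero] at this
    cases b <;> simp [this]
  have hker' : Module.finrank ℚ (LinearMap.ker G.incidence.transpose.mulVecLin) ≤ 1 := by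
    refine (Submodule.finrank_mono (t := ℚ ∙ (fun _ => 1 : V → ℚ)) ?_).trans
      (finrank_span_le_card (R := ℚ) ({fun _ => 1} : Set (V → ℚ)) |>.trans (by simp))
    intro h hh
    rw [LinearMap.mem_ker] at hh
    have hadj : ∀ e, h (G.src e) = h (G.tgt e) := by
      intro e
      have : ∑ x, G.incidence x e * h x = 0 := congrFun hh e
      simpa [MultiDigraph.incidence, sub_mul,
        Finset.sum_sub_distrib, sub_eq_zero] using this
    obtain ⟨s, hs⟩ := hs
    refine Submodule.mem_span_singleton.2 ⟨h s, ?_⟩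
    ext x
    simp only [Pi.smul_apply, smul_eq_mul, mul_one]
    induction hs x with
    | refl => rfl
    | tail _ hyz ih =>
      obtain ⟨e, rfl, rfl⟩ := hyz
      rw [ih, hadj]
  have r1 := LinearMap.finrank_range_add_finrank_ker M.faceCoboundary
  have r2 := LinearMap.finrank_range_add_finrank_ker G.incidence.mulVecLin
  have r3 := LinearMap.finrank_range_add_finrank_ker G.incidence.transpose.mulVecLin
  have r4 : Module.finrank ℚ (LinearMap.range G.incidence.transpose.mulVecLin) =
      Module.finrank ℚ (LinearMap.range G.incidence.mulVecLin) :=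
    Matrix.rank_transpose G.incidence
  rw [Module.finrank_fintype_fun_eq_card] at r1 r2 r3
  have hle : LinearMap.range M.faceCoboundary ≤ LinearMap.ker G.incidence.mulVecLin := by
    rintro _ ⟨h, rfl⟩
    rw [LinearMap.mem_ker]
    ext x
    rw [Matrix.mulVecLin_apply, incidence_mulVec, M.divergence_faceCoboundary]
    rfl
  -- The range has dimension at least `|F| - 1`. The circulations have dimension at most `|E| - |V|
  -- + 1`, which is the same number by Euler's formula with one component.
  have heq := Submodule.eq_of_le_of_finrank_le hle (by omega)
  have : J ∈ LinearMap.ker G.incidence.mulVecLin := by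
    rw [LinearMap.mem_ker]
    ext x
    rw [Matrix.mulVecLin_apply, incidence_mulVec, hJ]
    rfl
  rw [← heq] at this
  exact this

end Embedding

end PlanarReach

namespace PlanarReach

/-! ### Directed walks, their flows, and turning around a vertex -/

namespace MultiDigraph

variable {V : Type u} {E : Type v} (G : MultiDigraph V E)

/-- The list `l` of edges is a directed walk from `x` to `y`. -/
def IsWalk : V → List E → V → Prop
  | x, [], y => x = y
  | x, e :: l, y => G.src e = x ∧ IsWalk (G.tgt e) l y

variable {G}

theorem isWalk_append {x z : V} {l m : List E} :
    G.IsWalk x (l ++ m) z ↔ ∃ y, G.IsWalk x l y ∧ G.IsWalk y m z := by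
  induction l generalizing x with
  | nil => simp [IsWalk]
  | cons e l ih => simp [IsWalk, ih, and_assoc]

theorem IsWalk.append {x y z : V} {l m : List E} (hl : G.IsWalk x l y) (hm : G.IsWalk y m z) :
    G.IsWalk x (l ++ m) z := isWalk_append.2 ⟨y, hl, hm⟩

theorem IsWalk.snoc {x : V} {l : List E} {e : E} (hl : G.IsWalk x l (G.src e)) :
    G.IsWalk x (l ++ [e]) (G.tgt e) := hl.append ⟨rfl, rfl⟩

theorem IsWalk.unique {x y z : V} {l : List E} (hy : G.IsWalk x l y) (hz : G.IsWalk x l z) :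
    y = z := by
  induction l generalizing x with
  | nil => exact hy.symm.trans hz
  | cons e l ih => exact ih hy.2 hz.2

theorem IsWalk.right {x y z : V} {l m : List E} (h : G.IsWalk x (l ++ m) z)
    (hl : G.IsWalk x l y) : G.IsWalk y m z := by
  obtain ⟨y', h₁, h₂⟩ := isWalk_append.1 h
  rwa [hl.unique h₁]

theorem IsWalk.reach {x y : V} {l : List E} (h : G.IsWalk x l y) : G.Reach x y := by
  induction l generalizing x with
  | nil => rw [show x = y from h]; exact .refl
  | cons e l ih => exact .head ⟨e, h.1, rfl⟩ (ih h.2)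

/-- `y` is reachable from `x` by edges with the property `p`. -/
def ReachVia (G : MultiDigraph V E) (p : E → Prop) (x y : V) : Prop :=
  ∃ l, G.IsWalk x l y ∧ ∀ e ∈ l, p e

theorem ReachVia.reach {p : E → Prop} {x y : V} (h : G.ReachVia p x y) : G.Reach x y :=
  h.choose_spec.1.reach

theorem ReachVia.refl {p : E → Prop} (x : V) : G.ReachVia p x x := ⟨[], rfl, by simp⟩

theorem ReachVia.trans {p : E → Prop} {x y z : V} (h : G.ReachVia p x y)
    (h' : G.ReachVia p y z) : G.ReachVia p x z := by
  obtain ⟨l, hl, hp⟩ := h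
  obtain ⟨m, hm, hq⟩ := h'
  refine ⟨l ++ m, hl.append hm, fun e he => ?_⟩
  rcases List.mem_append.1 he with he | he
  exacts [hp e he, hq e he]

theorem ReachVia.single {p : E → Prop} {e : E} (h : p e) : G.ReachVia p (G.src e) (G.tgt e) :=
  ⟨[e], ⟨rfl, rfl⟩, by simpa using h⟩

theorem Reach.reachVia {p : E → Prop} {x y : V} (h : G.Reach x y)
    (hp : ∀ e, G.Reach (G.tgt e) y → p e) : G.ReachVia p x y := by
  induction h using Relation.ReflTransGen.head_induction_on with
  | refl => exact ReachVia.refl _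
  | head hab hby ih =>
    obtain ⟨e, rfl, rfl⟩ := hab
    exact (ReachVia.single (hp e hby)).trans ih

theorem reach_edge (e : E) : G.Reach (G.src e) (G.tgt e) := .single ⟨e, rfl, rfl⟩

theorem Acyclic.not_reach_src (hG : G.Acyclic) (e : E) : ¬ G.Reach (G.tgt e) (G.src e) :=
  fun h => hG _ (Relation.TransGen.head' ⟨e, rfl, rfl⟩ h)

theorem IsWalk.split_at {x y : V} {l : List E} (h : G.IsWalk x l y) {e : E} (he : e ∈ l) :
    ∃ c p, l = c ++ e :: p ∧ G.IsWalk x c (G.src e) ∧ G.IsWalk (G.tgt e) p y := by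
  obtain ⟨c, p, rfl⟩ := List.append_of_mem he
  obtain ⟨z, hc, h₁, h₂⟩ := isWalk_append.1 h
  subst h₁
  exact ⟨c, p, rfl, hc, h₂⟩

theorem IsWalk.reach_of_mem {x y : V} {l : List E} (h : G.IsWalk x l y) {e : E} (he : e ∈ l) :
    G.Reach x (G.src e) ∧ G.Reach (G.tgt e) y := by
  obtain ⟨c, p, -, hc, hp⟩ := h.split_at he
  exact ⟨hc.reach, hp.reach⟩

theorem IsWalk.eq_nil (hG : G.Acyclic) {x : V} {l : List E} (h : G.IsWalk x l x) : l = [] := by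
  cases l with
  | nil => rfl
  | cons e l =>
    obtain ⟨rfl, h⟩ := h
    exact absurd h.reach (hG.not_reach_src e)

theorem IsWalk.nodup (hG : G.Acyclic) {x y : V} {l : List E} (h : G.IsWalk x l y) :
    l.Nodup := by
  induction l generalizing x with
  | nil => exact List.nodup_nil
  | cons e l ih =>
    refine List.nodup_cons.2 ⟨fun he => ?_, ih h.2⟩
    exact hG.not_reach_src e (h.2.reach_of_mem he).1

/-- By acyclicity a walk repeats no edge, so its length is bounded. Finiteness makes walks with the
largest key exist. -/
theorem finite_walks [Finite E] (hG : G.Acyclic) (x y : V) : {l | G.IsWalk x l y}.Finite := by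
  have := Fintype.ofFinite E
  exact (List.finite_length_le E (Fintype.card E)).subset
    fun l hl => (IsWalk.nodup hG hl).length_le_card

open Classical in
/-- The flow of one unit along a walk, as an antisymmetric function of the darts. -/
noncomputable def walkFlow (l : List E) (d : Dart E) : ℚ :=
  if d.2 then (l.count d.1 : ℚ) else -(l.count d.1 : ℚ)

theorem walkFlow_eq_zero {l : List E} {d : Dart E} (h : d.1 ∉ l) : walkFlow l d = 0 := by
  classical
  simp [walkFlow, List.count_eq_zero.2 h]

open Classical in
/-- The flow of a walk at a vertex `x` on it. -/
theorem walkFlow_at (hG : G.Acyclic) {s x y : V} {c p : List E} (hc : G.IsWalk s c x)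
    (hp : G.IsWalk x p y) {d : Dart E} (hd : G.base d = x) :
    walkFlow (c ++ p) d = (if ∃ o, p.head? = some o ∧ d = (o, true) then 1 else 0) -
      (if ∃ a, c.getLast? = some a ∧ d = (a, false) then 1 else 0) := by
  obtain ⟨e, b⟩ := d
  cases b with
  | true =>
    rw [Embedding.base_out] at hd
    have h₁ : c.count e = 0 := List.count_eq_zero.2 fun he => by
      have := (hc.reach_of_mem he).2
      rw [← hd] at this
      exact hG.not_reach_src e this
    cases p with
    | nil => simp [walkFlow, h₁]
    | cons g p =>
      have h₂ : p.count e = 0 := List.count_eq_zero.2 fun he => by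
        have := (hp.2.reach_of_mem he).1
        rw [hd, ← hp.1] at this
        exact hG.not_reach_src g this
      by_cases hg : g = e
      · subst hg; simp [walkFlow, h₁, h₂]
      · have : ¬ e = g := fun h => hg h.symm
        simp [walkFlow, h₁, h₂, hg, this]
  | false =>
    rw [Embedding.base_in] at hd
    have h₁ : p.count e = 0 := List.count_eq_zero.2 fun he => by
      have := (hp.reach_of_mem he).1
      rw [← hd] at this
      exact hG.not_reach_src e this
    rcases List.eq_nil_or_concat' c with rfl | ⟨c, g, rfl⟩
    · simp [walkFlow, h₁]
    · obtain ⟨z, hc, h₃, h₄⟩ := isWalk_append.1 hc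
      have h₂ : c.count e = 0 := List.count_eq_zero.2 fun he => by
        have := (hc.reach_of_mem he).2
        rw [hd, ← show _ = x from h₄, ← h₃] at this
        exact hG.not_reach_src g this
      by_cases hg : g = e
      · subst hg; simp [walkFlow, h₁, h₂]
      · have : ¬ e = g := fun h => hg h.symm
        simp [walkFlow, h₁, h₂, hg, this]

/-- A vertex with nonzero flow is on the walk. -/
theorem exists_prefix_of_walkFlow_ne_zero {s y : V} {l : List E} (h : G.IsWalk s l y)
    {d : Dart E} (hd : walkFlow l d ≠ 0) :
    ∃ c p, l = c ++ p ∧ G.IsWalk s c (G.base d) ∧ G.IsWalk (G.base d) p y := by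
  have he : d.1 ∈ l := by
    by_contra he
    exact hd (walkFlow_eq_zero he)
  obtain ⟨c, p, rfl, hc, hp⟩ := h.split_at he
  obtain ⟨e, b⟩ := d
  cases b with
  | true => exact ⟨c, e :: p, rfl, hc, rfl, hp⟩
  | false => exact ⟨c ++ [e], p, by simp, hc.snoc, hp⟩

open Classical in
theorem divergence_walk [Fintype E] {x y : V} {l : List E} (h : G.IsWalk x l y) (z : V) :
    G.divergence (fun e => (l.count e : ℚ)) z =
      (if x = z then 1 else 0) - if y = z then 1 else 0 := by
  induction l generalizing x with
  | nil => rw [show x = y from h]; simp [divergence]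
  | cons e l ih =>
    obtain ⟨rfl, h⟩ := h
    have := ih h
    have key : G.divergence (fun g => ((e :: l).count g : ℚ)) z =
        G.divergence (fun g => (l.count g : ℚ)) z +
          ∑ g, if e = g then ((if G.src g = z then 1 else 0) - if G.tgt g = z then (1 : ℚ) else 0)
            else 0 := by
      unfold divergence
      rw [← Finset.sum_add_distrib]
      refine Finset.sum_congr rfl fun g _ => ?_
      by_cases hg : e = g
      · subst hg
        by_cases h₁ : G.src e = z <;> by_cases h₂ : G.tgt e = z <;> simp [h₁, h₂, add_comm]
      · simp [hg]
    rw [key, this, Finset.sum_ite_eq]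
    simp

end MultiDigraph

namespace Embedding

open MultiDigraph

variable {V : Type u} {E : Type v} {G : MultiDigraph V E} (M : Embedding G)

/-- A potential for the difference of two walks with the same ends. -/
theorem exists_walk_potential [Finite V] [Finite E] (hs : G.SingleSource) (hM : M.IsPlane)
    {x y : V} {P Q : List E} (hP : G.IsWalk x P y) (hQ : G.IsWalk x Q y) :
    ∃ h : M.Face → ℚ, ∀ d,
      h (M.faceOf d) = h (M.faceOf (Dart.rev d)) + (walkFlow P d - walkFlow Q d) := by
  classical
  have := Fintype.ofFinite E
  obtain ⟨h, hh⟩ := M.exists_face_potential hs hM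
    (fun e => (P.count e : ℚ) - (Q.count e : ℚ)) (fun z => by
      have h₁ := divergence_walk hP z
      have h₂ := divergence_walk hQ z
      have : G.divergence (fun e => (P.count e : ℚ) - (Q.count e : ℚ)) z =
          G.divergence (fun e => (P.count e : ℚ)) z -
            G.divergence (fun e => (Q.count e : ℚ)) z := by
        unfold divergence
        rw [← Finset.sum_sub_distrib]
        refine Finset.sum_congr rfl fun e _ => ?_
        by_cases h₁ : G.src e = z <;> by_cases h₂ : G.tgt e = z <;>
          simp [h₁, h₂, sub_eq_add_neg, add_comm]
      rw [this, h₁, h₂, sub_self])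
  refine ⟨h, fun ⟨e, b⟩ => ?_⟩
  have := congrFun hh e
  simp only [faceCoboundary, LinearMap.coe_mk, AddHom.coe_mk] at this
  cases b <;> simp [walkFlow] <;> linarith

theorem pow_sub_apply {α : Type*} {σ : Equiv.Perm α} {r a b : α} {m n : ℕ} (h₁ : (σ ^ m) r = a)
    (h₂ : (σ ^ n) r = b) (h : m ≤ n) : (σ ^ (n - m)) a = b := by
  rw [← h₁, ← Equiv.Perm.mul_apply, ← pow_add, Nat.sub_add_cancel h, h₂]

/-- The number of steps of the rotation from `r` to `d`, counted so that it is `0` for the dart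
after `r` and largest for `r` itself. -/
noncomputable def pos (r d : Dart E) : ℕ := sInf {k | (M.rot ^ (k + 1)) r = d}

theorem pow_pos_add_one [Finite E] {r d : Dart E} (h : G.base r = G.base d) :
    (M.rot ^ (M.pos r d + 1)) r = d := by
  refine Nat.sInf_mem (s := {k | (M.rot ^ (k + 1)) r = d}) ?_
  obtain ⟨k, hk⟩ := M.exists_pow_eq (show G.base (M.rot r) = G.base d by rw [M.base_rot, h])
  exact ⟨k, by rw [Set.mem_ofPred_eq, pow_succ, Equiv.Perm.mul_apply, hk]⟩

theorem pos_le {r d : Dart E} {k : ℕ} (h : (M.rot ^ (k + 1)) r = d) : M.pos r d ≤ k :=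
  Nat.sInf_le h

theorem pos_injective [Finite E] {r d d' : Dart E} (h : G.base r = G.base d)
    (h' : G.base r = G.base d') (hp : M.pos r d = M.pos r d') : d = d' := by
  rw [← M.pow_pos_add_one h, ← M.pow_pos_add_one h', hp]

/-- No dart is met twice before the turn from `r` first arrives at `g`, so a dart met by then is met
at its own position. -/
theorem eq_pos [Finite E] {r d g : Dart E} (hg : G.base r = G.base g) {i : ℕ}
    (hi : i ≤ M.pos r g) (h : (M.rot ^ (i + 1)) r = d) : i = M.pos r d := by
  have hd : G.base r = G.base d := by rw [← h, M.base_pow]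
  rcases (M.pos_le h).eq_or_lt with h' | h'
  · exact h'.symm
  exfalso
  have h₁ := M.pow_pos_add_one hd
  have h₂ := M.pow_pos_add_one hg
  have h₃ : (M.rot ^ (M.pos r g - (i - M.pos r d) + 1)) r = g := by
    rw [show M.pos r g - (i - M.pos r d) + 1 = (M.pos r g - i) + (M.pos r d + 1) by omega,
      pow_add, Equiv.Perm.mul_apply, h₁, ← h, ← Equiv.Perm.mul_apply, ← pow_add,
      show M.pos r g - i + (i + 1) = M.pos r g + 1 by omega, h₂]
  have := M.pos_le h₃
  omega

theorem pos_lt_pos_self [Finite E] {r d : Dart E} (h : G.base r = G.base d) (hne : d ≠ r) :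
    M.pos r d < M.pos r r := by
  by_contra hlt
  have := M.eq_pos h (not_lt.1 hlt) (M.pow_pos_add_one rfl)
  have h₁ := M.pow_pos_add_one h
  have h₂ := M.pow_pos_add_one (rfl : G.base r = G.base r)
  rcases (not_lt.1 hlt).eq_or_lt with h₃ | h₃
  · rw [← h₃, h₂] at h₁
    exact hne h₁.symm
  · have h₄ := pow_sub_apply h₂ h₁ (by omega)
    rw [show M.pos r d + 1 - (M.pos r r + 1) = M.pos r d - M.pos r r - 1 + 1 by omega] at h₄
    have := M.pos_le h₄
    omega

/-- If the darts `e` and `o` are met in this order when turning from `a` and in the other order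
when turning from `b`, then `b` lies between `e` and `o`. -/
theorem pos_separates [Finite E] {a b e o : Dart E} (hb : G.base a = G.base b)
    (he : G.base a = G.base e) (ho : G.base a = G.base o) (hao : M.pos a e < M.pos a o)
    (hbe : M.pos b o < M.pos b e) : M.pos a e ≤ M.pos a b ∧ M.pos a b ≤ M.pos a o := by
  have h₁ := M.pow_pos_add_one he
  have h₂ := M.pow_pos_add_one ho
  have h₃ := M.pow_pos_add_one hb
  have h₄ := M.pow_pos_add_one (hb.symm.trans ho)
  have h₅ := M.pow_pos_add_one (hb.symm.trans he)
  by_contra hcon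
  rcases lt_or_ge (M.pos a b) (M.pos a e) with hlt | hge
  · have h₆ := pow_sub_apply h₃ h₁ (by omega)
    rw [show M.pos a e + 1 - (M.pos a b + 1) = M.pos a e - M.pos a b - 1 + 1 by omega] at h₆
    have h₇ := M.pos_le h₆
    have h₈ : (M.rot ^ (M.pos b o + 1 + M.pos a b + 1)) a = o := by
      rw [add_assoc, pow_add, Equiv.Perm.mul_apply, h₃, h₄]
    have h₉ := M.pos_le h₈
    omega
  · have h₆ := pow_sub_apply h₄ h₅ (by omega)
    have hob := pow_sub_apply h₂ h₃ (by omega)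
    rcases le_or_gt (M.pos b e + 1 - (M.pos b o + 1)) (M.pos a b + 1 - (M.pos a o + 1))
      with h₇ | h₇
    · have h₈ : (M.rot ^ (M.pos b e + 1 - (M.pos b o + 1) + M.pos a o + 1)) a = e := by
        rw [add_assoc, pow_add, Equiv.Perm.mul_apply, h₂, h₆]
      have h₉ := M.eq_pos hb (by omega) h₈
      omega
    · have h₈ := pow_sub_apply hob h₆ h₇.le
      rw [show M.pos b e + 1 - (M.pos b o + 1) - (M.pos a b + 1 - (M.pos a o + 1)) =
        M.pos b e + 1 - (M.pos b o + 1) - (M.pos a b + 1 - (M.pos a o + 1)) - 1 + 1 by omega] at h₈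
      have h₉ := M.pos_le h₈
      omega

/-- Turning from `r` to `g`, a function of the corners changes by the jumps at the darts between
them. -/
theorem turn_eq [Finite E] {K j : Dart E → ℚ} (hK : ∀ d, K (M.rot d) = K d + j (M.rot d))
    {r g : Dart E} (hg : G.base r = G.base g) :
    K g = K r + ∑ i ∈ Finset.range (M.pos r g + 1), j ((M.rot ^ (i + 1)) r) := by
  have : ∀ k, K ((M.rot ^ k) r) = K r + ∑ i ∈ Finset.range k, j ((M.rot ^ (i + 1)) r) := by
    intro k
    induction k with
    | zero => simp
    | succ k ih =>
      rw [pow_succ', Equiv.Perm.mul_apply, hK, ih, Finset.sum_range_succ, add_assoc,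
        ← Equiv.Perm.mul_apply, ← pow_succ']
  rw [← this, M.pow_pos_add_one hg]

open Classical in
/-- `turn_eq` for jumps at two darts only. -/
theorem turn_eq_of_two [Finite E] {K j : Dart E → ℚ}
    (hK : ∀ d, K (M.rot d) = K d + j (M.rot d)) {r g d₁ d₂ : Dart E} (hg : G.base r = G.base g)
    (h₁ : G.base r = G.base d₁) (h₂ : G.base r = G.base d₂)
    (hj : ∀ d, G.base d = G.base r →
      j d = (if d = d₁ then 1 else 0) - (if d = d₂ then 1 else 0)) :
    K g = K r + (if M.pos r d₁ ≤ M.pos r g then 1 else 0) -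
      (if M.pos r d₂ ≤ M.pos r g then 1 else 0) := by
  have key : ∀ d, G.base r = G.base d →
      (∑ i ∈ Finset.range (M.pos r g + 1), if (M.rot ^ (i + 1)) r = d then (1 : ℚ) else 0) =
        if M.pos r d ≤ M.pos r g then 1 else 0 := by
    intro d hd
    have : ∀ i ∈ Finset.range (M.pos r g + 1),
        (if (M.rot ^ (i + 1)) r = d then (1 : ℚ) else 0) = if M.pos r d = i then 1 else 0 := by
      intro i hi
      rw [Finset.mem_range] at hi
      by_cases h : (M.rot ^ (i + 1)) r = d
      · rw [if_pos h, if_pos (M.eq_pos hg (by omega) h).symm]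
      · rw [if_neg h, if_neg]
        rintro rfl
        exact h (M.pow_pos_add_one hd)
    rw [Finset.sum_congr rfl this, Finset.sum_ite_eq]
    simp
  rw [M.turn_eq hK hg, Finset.sum_congr rfl fun i _ => hj _ (by rw [M.base_pow]),
    Finset.sum_sub_distrib, key _ h₁, key _ h₂, add_sub_assoc]

end Embedding

end PlanarReach

namespace PlanarReach

/-! ### Extreme walks and the potential between two of them -/

namespace Embedding

open MultiDigraph

variable {V : Type u} {E : Type v} {G : MultiDigraph V E} (M : Embedding G)

/-- The dart by which the walk `c` arrives, or `r` if the walk is empty. -/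
def refDart (r : Dart E) (c : List E) : Dart E :=
  match c.getLast? with
  | none => r
  | some g => (g, false)

@[simp] theorem refDart_concat (r : Dart E) (c : List E) (g : E) :
    refDart r (c ++ [g]) = (g, false) := by
  simp [refDart]

theorem refDart_cons (r : Dart E) (c : List E) (g : E) :
    refDart r (g :: c) = refDart (g, false) c := by
  rcases List.eq_nil_or_concat' c with rfl | ⟨c, a, rfl⟩
  · rfl
  · rw [← List.cons_append, refDart_concat, refDart_concat]

theorem base_refDart {r : Dart E} {s x : V} {c : List E} (hr : G.base r = s)
    (hc : G.IsWalk s c x) : G.base (refDart r c) = x := by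
  rcases List.eq_nil_or_concat' c with rfl | ⟨c, a, rfl⟩
  · exact hr.trans hc
  · rw [refDart_concat]
    obtain ⟨z, -, -, h⟩ := isWalk_append.1 hc
    exact h

theorem exists_getLast_iff (r d : Dart E) {c : List E} (hc : c ≠ []) :
    (∃ a, c.getLast? = some a ∧ d = (a, false)) ↔ d = refDart r c := by
  rcases List.eq_nil_or_concat' c with rfl | ⟨c, a, rfl⟩
  · exact absurd rfl hc
  · simp

/-- The turns of a walk that starts with the dart `r` in its back, with the sign `σ`. -/
noncomputable def key (σ : ℤ) : Dart E → List E → List ℤ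
  | _, [] => []
  | r, e :: l => (σ * M.pos r (e, true)) :: key σ (e, false) l

/-- The walk `P` branches off from the walk `Q` to the side of smaller turns. -/
def Diverges (σ : ℤ) (r : Dart E) (P Q : List E) : Prop :=
  ∃ c d d' p q, P = c ++ d :: p ∧ Q = c ++ d' :: q ∧
    σ * M.pos (refDart r c) (d, true) < σ * M.pos (refDart r c) (d', true)

variable {M}

/-- The keys agree along the common part `c`, where arriving darts and turns coincide, and first
differ at the branching. -/
theorem Diverges.key_lt {σ : ℤ} {r : Dart E} {P Q : List E} (h : M.Diverges σ r P Q) :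
    M.key σ r P < M.key σ r Q := by
  obtain ⟨c, d, d', p, q, rfl, rfl, h⟩ := h
  induction c generalizing r with
  | nil => exact List.cons_lt_cons_iff.2 (Or.inl h)
  | cons g c ih =>
    rw [refDart_cons] at h
    exact List.cons_lt_cons_iff.2 (Or.inr ⟨rfl, ih h⟩)

theorem Diverges.append {σ : ℤ} {r : Dart E} {P Q : List E} (h : M.Diverges σ r P Q)
    (l m : List E) : M.Diverges σ r (P ++ l) (Q ++ m) := by
  obtain ⟨c, d, d', p, q, rfl, rfl, h⟩ := h
  exact ⟨c, d, d', p ++ l, q ++ m, by simp, by simp, h⟩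

theorem key_lt_append (σ : ℤ) (r : Dart E) (P : List E) {l : List E} (hl : l ≠ []) :
    M.key σ r P < M.key σ r (P ++ l) := by
  induction P generalizing r with
  | nil =>
    cases l with
    | nil => exact absurd rfl hl
    | cons e l => exact List.nil_lt_cons _ _
  | cons e P ih => exact List.cons_lt_cons_iff.2 (Or.inr ⟨rfl, ih _⟩)

/-- Different outgoing darts have different positions, so equal turns mean equal edges, and the
first difference of the keys is a branching of the walks. -/
theorem diverges_or_prefix [Finite E] {σ : ℤ} (hσ : σ ≠ 0) {r : Dart E} {x y z : V}
    {P Q : List E} (hr : G.base r = x) (hP : G.IsWalk x P y) (hQ : G.IsWalk x Q z)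
    (h : M.key σ r P ≤ M.key σ r Q) : M.Diverges σ r P Q ∨ ∃ m, Q = P ++ m := by
  induction P generalizing r x Q with
  | nil => exact Or.inr ⟨Q, rfl⟩
  | cons e P ih =>
    cases Q with
    | nil => exact absurd h (by simp [key])
    | cons g Q =>
      have h : σ * (M.pos r (e, true) : ℤ) < σ * M.pos r (g, true) ∨
          σ * (M.pos r (e, true) : ℤ) = σ * M.pos r (g, true) ∧
            M.key σ (e, false) P ≤ M.key σ (g, false) Q := by
        rcases h.lt_or_eq with h | h
        · exact (List.cons_lt_cons_iff.1 h).imp_right fun h => ⟨h.1, h.2.le⟩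
        · exact Or.inr ⟨(List.cons.inj h).1, (List.cons.inj h).2.le⟩
      rcases h with h | ⟨h₁, h₂⟩
      · exact Or.inl ⟨[], e, g, P, Q, rfl, rfl, h⟩
      · have h₃ := M.pos_injective (r := r) (d := (e, true)) (d' := (g, true))
          (hr.trans hP.1.symm) (hr.trans hQ.1.symm)
          (by exact_mod_cast mul_left_cancel₀ hσ h₁)
        obtain rfl : e = g := congrArg Prod.fst h₃
        rcases ih (r := (e, false)) rfl hP.2 hQ.2 h₂ with ⟨c, d, d', p, q, rfl, rfl, h⟩ | ⟨m, rfl⟩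
        · refine Or.inl ⟨e :: c, d, d', p, q, rfl, rfl, ?_⟩
          rwa [refDart_cons]
        · exact Or.inr ⟨m, rfl⟩

variable (M)

/-- `P` has the largest key among the walks from `s` to `y` with edges that have the
property `p`. -/
structure IsMaxWalk (σ : ℤ) (r : Dart E) (p : E → Prop) (s y : V) (P : List E) : Prop where
  walk : G.IsWalk s P y
  prop : ∀ e ∈ P, p e
  max : ∀ Q, G.IsWalk s Q y → (∀ e ∈ Q, p e) → M.key σ r Q ≤ M.key σ r P

theorem exists_isMaxWalk [Finite E] (hG : G.Acyclic) (σ : ℤ) (r : Dart E) {p : E → Prop}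
    {s y : V} (h : G.ReachVia p s y) : ∃ P, M.IsMaxWalk σ r p s y P := by
  have hfin : {l | G.IsWalk s l y ∧ ∀ e ∈ l, p e}.Finite :=
    (finite_walks hG s y).subset fun l hl => hl.1
  obtain ⟨P, hP, hmax⟩ := Set.exists_max_image _ (M.key σ r) hfin h
  exact ⟨P, hP.1, hP.2, fun Q h₁ h₂ => hmax Q ⟨h₁, h₂⟩⟩

variable {M}

/-- Walks with the largest key have the same initial parts up to a common vertex. -/
theorem IsMaxWalk.prefix_unique [Finite E] (hG : G.Acyclic) {σ : ℤ} (hσ : σ ≠ 0) {r : Dart E}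
    {p : E → Prop} {s y y' z : V} {P P' Q Q' : List E} (hr : G.base r = s)
    (hP : M.IsMaxWalk σ r p s y (P ++ P')) (hQ : M.IsMaxWalk σ r p s y' (Q ++ Q'))
    (hPz : G.IsWalk s P z) (hQz : G.IsWalk s Q z) : P = Q := by
  have hpP := hP.prop
  have hpQ := hQ.prop
  simp only [List.mem_append] at hpP hpQ
  have key : ∀ {l m : List E}, G.IsWalk s l z → G.IsWalk s (l ++ m) z → m = [] :=
    fun hl hm => (hm.right hl).eq_nil hG
  rcases le_total (M.key σ r P) (M.key σ r Q) with h | h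
  · rcases diverges_or_prefix hσ hr hPz hQz h with h | ⟨m, rfl⟩
    -- If `Q` had the larger key, replacing the initial part `P` by `Q` would beat the extreme walk
    -- `P ++ P'`.
    · refine absurd (h.append P' P').key_lt (not_lt.2 (hP.max _ ?_ ?_))
      · exact hQz.append (hP.walk.right hPz)
      · intro e he
        rcases List.mem_append.1 he with he | he
        exacts [hpQ e (Or.inl he), hpP e (Or.inr he)]
    · simp [key hPz hQz]
  · rcases diverges_or_prefix hσ hr hQz hPz h with h | ⟨m, rfl⟩
    · refine absurd (h.append Q' Q').key_lt (not_lt.2 (hQ.max _ ?_ ?_))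
      · exact hPz.append (hQ.walk.right hQz)
      · intro e he
        rcases List.mem_append.1 he with he | he
        exacts [hpP e (Or.inl he), hpQ e (Or.inr he)]
    · simp [key hQz hPz]

/-- `h` is a potential for the difference of the walks `P` and `Q`. -/
def IsWalkPotential (M : Embedding G) (P Q : List E) (h : M.Face → ℚ) : Prop :=
  ∀ d, h (M.faceOf d) = h (M.faceOf (Dart.rev d)) + (walkFlow P d - walkFlow Q d)

namespace IsWalkPotential

variable {P Q : List E} {h : M.Face → ℚ}

theorem rot (hh : M.IsWalkPotential P Q h) (d : Dart E) : h (M.faceOf (M.rot d)) =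
    h (M.faceOf d) + (walkFlow P (M.rot d) - walkFlow Q (M.rot d)) := by
  rw [hh (M.rot d), ← M.faceOf_symm, Equiv.symm_apply_apply]

theorem const_at [Finite E] (hh : M.IsWalkPotential P Q h) {x : V}
    (hx : ∀ d, G.base d = x → walkFlow P d = walkFlow Q d) {d d' : Dart E} (hd : G.base d = x)
    (hd' : G.base d' = x) : h (M.faceOf d) = h (M.faceOf d') :=
  M.const_at (fun d => h (M.faceOf d))
    (fun d hd => by rw [hh.rot, hx _ ((M.base_rot d).trans hd), sub_self, add_zero]) hd hd'

/-- The potential is constant along a walk through vertices without flow. -/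
theorem eq_of_walk [Finite E] (hh : M.IsWalkPotential P Q h) {S : Set V}
    (hS : ∀ d, G.base d ∈ S → walkFlow P d = walkFlow Q d) {f : M.Face} {z a : V} {l : List E}
    (hl : G.IsWalk z l a) (ha : a ∈ M.faceVerts f) (hz : z ∈ S) (hlS : ∀ e ∈ l, G.tgt e ∈ S)
    {d : Dart E} (hd : G.base d = z) : h (M.faceOf d) = h f := by
  induction l generalizing z d with
  | nil =>
    obtain rfl : z = a := hl
    rcases ha with ⟨d', hd', rfl⟩ | ⟨hno, -⟩
    · exact hh.const_at (fun d hd => hS d (hd ▸ hz)) hd hd'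
    · exact absurd hd (hno d)
  | cons e l ih =>
    have he : G.tgt e ∈ S := hlS e (by simp)
    rw [← ih hl.2 he (fun g hg => hlS g (by simp [hg])) (d := M.rot.symm (e, false))
      (M.base_symm _), M.faceOf_symm]
    exact hh.const_at (fun d hd => hS d (hd ▸ hz)) hd hl.1

/-- The potential is constant along the common initial part of the two walks. -/
theorem eq_of_prefix [Finite E] (hG : G.Acyclic) (hh : M.IsWalkPotential P Q h) {s w : V}
    (hP : G.IsWalk s P w) (hQ : G.IsWalk s Q w) {r : Dart E} (hr : G.base r = s)
    {c p q : List E} (hcP : P = c ++ p) (hcQ : Q = c ++ q) :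
    h (M.faceOf (refDart r c)) = h (M.faceOf r) := by
  induction c using List.reverseRecOn generalizing p q with
  | nil => rfl
  | append_singleton c g ih =>
    rw [List.append_assoc, List.singleton_append] at hcP hcQ
    rw [← ih hcP hcQ, refDart_concat]
    obtain ⟨x, hc, hgp⟩ := isWalk_append.1 (hcP ▸ hP)
    have hgq := (hcQ ▸ hQ : G.IsWalk s (c ++ g :: q) w).right hc
    have := M.faceOf_symm (g, true)
    rw [rev_mk, Bool.not_true] at this
    rw [← this]
    refine hh.const_at (x := x) (fun d hd => ?_) ((M.base_symm _).trans hgp.1)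
      (base_refDart hr hc)
    rw [hcP, hcQ, walkFlow_at hG hc hgp hd, walkFlow_at hG hc hgq hd]
    rfl

end IsWalkPotential

open Classical in
theorem walkFlow_at_cons (hG : G.Acyclic) {s x y : V} {c p : List E} {o : E} {r : Dart E}
    (hne : c ≠ []) (hc : G.IsWalk s c x) (hp : G.IsWalk x (o :: p) y) {d : Dart E}
    (hd : G.base d = x) : walkFlow (c ++ o :: p) d =
      (if d = (o, true) then 1 else 0) - (if d = refDart r c then 1 else 0) := by
  rw [walkFlow_at hG hc hp hd]
  simp only [exists_getLast_iff r d hne]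
  simp

theorem walkFlow_end (hG : G.Acyclic) {s x : V} {c : List E} {r : Dart E}
    (hne : c ≠ []) (hc : G.IsWalk s c x) {d : Dart E} (hd : G.base d = x) [DecidableEq E] :
    walkFlow c d = -(if d = refDart r c then 1 else 0) := by
  have := walkFlow_at hG hc (show G.IsWalk x [] x from rfl) hd
  simp only [exists_getLast_iff r d hne] at this
  simp only [List.append_nil] at this
  rw [this]
  simp

open Classical in
theorem walkFlow_sub_at (hG : G.Acyclic) {s x y y' : V} {c p q : List E} {o o' : E}
    (hc : G.IsWalk s c x) (hp : G.IsWalk x (o :: p) y) (hq : G.IsWalk x (o' :: q) y')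
    {d : Dart E} (hd : G.base d = x) :
    walkFlow (c ++ o :: p) d - walkFlow (c ++ o' :: q) d =
      (if d = (o, true) then 1 else 0) - (if d = (o', true) then 1 else 0) := by
  rw [walkFlow_at hG hc hp hd, walkFlow_at hG hc hq hd]
  simp

/-- Let the walk `α` to `u` continue with `o` to `w`, and let it diverge from the walk `Q` to `w`
already if it continues with `e`, which lies between `o` and `Q`. Then `e` lies between the two
walks to `w`. -/
theorem potential_between [Finite E] (hG : G.Acyclic) {σ : ℤ} (hσ : σ = 1 ∨ σ = -1)
    {r : Dart E} {p : E → Prop} {s u w : V} {α Q ω : List E} {e o : E} {h : M.Face → ℚ}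
    (hr : G.base r = s) (hα : M.IsMaxWalk σ r p s u α) (hQ : M.IsMaxWalk σ r p s w Q)
    (hω : G.IsWalk u (o :: ω) w) (he : G.src e = u) (hdiv : M.Diverges σ r (α ++ [e]) Q)
    (ho : σ * M.pos (refDart r α) (o, true) < σ * M.pos (refDart r α) (e, true))
    (hh : M.IsWalkPotential (α ++ o :: ω) Q h) :
    h (M.faceOf (e, true)) = h (M.faceOf r) + σ := by
  classical
  have hσ0 : σ ≠ 0 := by rcases hσ with rfl | rfl <;> norm_num
  have hP := hα.walk.append hω
  obtain ⟨c, d, d', p, q, hcα, rfl, hdd⟩ := hdiv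
  rcases List.eq_nil_or_concat' p with rfl | ⟨p, g, rfl⟩
  · obtain ⟨rfl, hde⟩ := List.append_inj' hcα rfl
    obtain rfl : e = d := by simpa using hde
    have hq := hQ.walk.right hα.walk
    have hb := base_refDart hr hα.walk
    -- Here `Q` passes through `u` as well. The potential jumps by 1 at `o` and by -1 at `d'`, and
    -- `e` lies strictly between them; `σ` tells which of the two is passed on the way to `e`.
    rw [M.turn_eq_of_two (K := fun d => h (M.faceOf d))
      (j := fun δ => walkFlow (α ++ o :: ω) δ - walkFlow (α ++ d' :: q) δ)
      (r := refDart r α) (g := (e, true)) (d₁ := (o, true)) (d₂ := (d', true)) hh.rot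
      (hb.trans he.symm) (hb.trans hω.1.symm) (hb.trans hq.1.symm)
      (fun δ hδ => walkFlow_sub_at hG hα.walk hω hq (hδ.trans hb)),
      hh.eq_of_prefix hG hP hQ.walk hr rfl rfl]
    rcases hσ with rfl | rfl
    · rw [if_pos (by omega), if_neg (by omega)]
      simp
    · rw [if_neg (by omega), if_pos (by omega)]
      push_cast
      ring
  · rw [← List.cons_append, ← List.append_assoc] at hcα
    obtain ⟨rfl, hde⟩ := List.append_inj' hcα rfl
    have hdd' : d ≠ d' := by
      rintro rfl
      exact lt_irrefl _ hdd
    obtain ⟨x, hcx, hpx⟩ := isWalk_append.1 hα.walk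
    have hq := hQ.walk.right hcx
    -- Beyond the branching the potential on the right side of `α` stays constant; it is lower by 1
    -- than at `r` exactly if `Q` leaves on that side.
    have step : ∀ p₁ p₂, p = p₁ ++ p₂ → h (M.faceOf (refDart r (c ++ d :: p₁))) =
        h (M.faceOf r) - (if M.pos (refDart r c) (d', true) ≤ M.pos (refDart r c) (d, true)
          then 1 else 0) := by
      intro p₁
      induction p₁ using List.reverseRecOn with
      | nil =>
        intro p₂ _
        have hb := base_refDart hr hcx
        have hp' : G.IsWalk x (d :: (p ++ o :: ω)) w := by
          have := hpx.append hω
          simpa using this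
        have hP' : G.IsWalk s (c ++ d :: (p ++ o :: ω)) w := hcx.append hp'
        have hh' : M.IsWalkPotential (c ++ d :: (p ++ o :: ω)) (c ++ d' :: q) h := by
          simpa using hh
        have h₁ := M.turn_eq_of_two (K := fun d => h (M.faceOf d)) (r := refDart r c)
          (j := fun δ => walkFlow (c ++ d :: (p ++ o :: ω)) δ - walkFlow (c ++ d' :: q) δ)
          (g := (d, true)) (d₁ := (d, true)) (d₂ := (d', true)) hh'.rot (hb.trans hp'.1.symm)
          (hb.trans hp'.1.symm) (hb.trans hq.1.symm)
          (fun δ hδ => walkFlow_sub_at hG hcx hp' hq (hδ.trans hb))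
        have h₂ := hh' (d, true)
        rw [walkFlow_sub_at hG hcx hp' hq (d := (d, true)) hp'.1] at h₂
        rw [hh'.eq_of_prefix hG hP' hQ.walk hr rfl rfl] at h₁
        simp only [le_refl, if_true, Prod.mk.injEq, hdd', false_and, if_false,
          rev_mk, Bool.not_true] at h₁ h₂
        rw [refDart_concat]
        linarith
      | append_singleton p₁ g ih =>
        rintro p₂ hpp
        rw [List.append_assoc, List.singleton_append] at hpp
        have ih := ih _ hpp
        subst hpp
        have hne : c ++ d :: p₁ ≠ [] := by simp
        have e₁ : c ++ d :: (p₁ ++ g :: p₂) = (c ++ d :: p₁) ++ g :: p₂ := by simp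
        have e₂ : (c ++ d :: (p₁ ++ g :: p₂)) ++ o :: ω =
          (c ++ d :: p₁) ++ g :: (p₂ ++ o :: ω) := by simp
        obtain ⟨z, hz, hgz⟩ := isWalk_append.1 (e₁ ▸ hα.walk)
        have hb := base_refDart hr hz
        have hgz' : G.IsWalk z (g :: (p₂ ++ o :: ω)) w := hgz.append hω
        -- If `Q` met `α` again, the initial parts of these two extreme walks would coincide by
        -- `IsMaxWalk.prefix_unique`, although they differ in `d` and `d'`.
        have hQz : ∀ δ, G.base δ = z → walkFlow (c ++ d' :: q) δ = 0 := by
          intro δ hδ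
          by_contra h0
          obtain ⟨q₁, q₂, hqq, hq₁, -⟩ := exists_prefix_of_walkFlow_ne_zero hQ.walk h0
          have := IsMaxWalk.prefix_unique hG hσ0 hr (e₁ ▸ hα) (hqq ▸ hQ) hz (hδ ▸ hq₁)
          rw [← this, List.append_assoc] at hqq
          have := List.append_cancel_left hqq
          simp only [List.cons_append, List.cons.injEq] at this
          exact hdd' this.1.symm
        rw [e₂] at hh
        have hflow : ∀ δ, G.base δ = z →
            walkFlow (c ++ d :: p₁ ++ g :: (p₂ ++ o :: ω)) δ - walkFlow (c ++ d' :: q) δ =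
            (if δ = (g, true) then 1 else 0) -
              (if δ = refDart r (c ++ d :: p₁) then 1 else 0) := by
          intro δ hδ
          rw [hQz δ hδ, sub_zero, walkFlow_at_cons hG hne hz hgz' hδ]
        have hρ : (g, true) ≠ refDart r (c ++ d :: p₁) := by
          rcases List.eq_nil_or_concat' (c ++ d :: p₁) with h₀ | ⟨l, b, h₀⟩
          · exact absurd h₀ hne
          · rw [h₀, refDart_concat]; simp
        have h₁ := M.turn_eq_of_two (K := fun d => h (M.faceOf d))
          (j := fun δ => walkFlow (c ++ d :: p₁ ++ g :: (p₂ ++ o :: ω)) δ -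
            walkFlow (c ++ d' :: q) δ)
          (r := refDart r (c ++ d :: p₁)) (g := (g, true)) (d₁ := (g, true))
          (d₂ := refDart r (c ++ d :: p₁))
          hh.rot (hb.trans hgz.1.symm) (hb.trans hgz.1.symm) rfl
          (fun δ hδ => hflow δ (hδ.trans hb))
        have h₂ := hh (g, true)
        -- The arriving dart comes last in its own turn, so its jump is not yet counted at `g`.
        have h₃ := M.pos_lt_pos_self (hb.trans (show _ = G.base (g, true) from hgz.1.symm)) hρ
        rw [hflow (g, true) hgz.1] at h₂
        rw [if_neg (not_le.2 h₃)] at h₁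
        simp only [le_refl, if_true, if_neg hρ, rev_mk, Bool.not_true] at h₁ h₂
        rw [show c ++ d :: (p₁ ++ [g]) = (c ++ d :: p₁) ++ [g] by simp, refDart_concat]
        linarith
    have h₁ := step p [] (by simp)
    have hb := base_refDart hr hα.walk
    have hne : c ++ d :: p ≠ [] := by simp
    have hρ : (e, true) ≠ refDart r (c ++ d :: p) := by
      rcases List.eq_nil_or_concat' (c ++ d :: p) with h₀ | ⟨l, b, h₀⟩
      · exact absurd h₀ hne
      · rw [h₀, refDart_concat]; simp
    have hQu : ∀ δ, G.base δ = u → walkFlow (c ++ d' :: q) δ = 0 := by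
      intro δ hδ
      by_contra h0
      obtain ⟨q₁, q₂, hqq, hq₁, -⟩ := exists_prefix_of_walkFlow_ne_zero hQ.walk h0
      have := IsMaxWalk.prefix_unique (P' := []) hG hσ0 hr (by simpa using hα) (hqq ▸ hQ)
        hα.walk (hδ ▸ hq₁)
      rw [← this, List.append_assoc] at hqq
      have := List.append_cancel_left hqq
      simp only [List.cons_append, List.cons.injEq] at this
      exact hdd' this.1.symm
    -- At `u` only `o` and the arriving dart carry flow. The turn to `e` passes `o` exactly if `σ =
    -- 1`; otherwise the value -1 comes from the branching.
    have h₂ := M.turn_eq_of_two (K := fun d => h (M.faceOf d))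
      (j := fun δ => walkFlow (c ++ d :: p ++ o :: ω) δ - walkFlow (c ++ d' :: q) δ)
      (r := refDart r (c ++ d :: p)) (d₁ := (o, true)) (d₂ := refDart r (c ++ d :: p))
      hh.rot (g := (e, true)) (hb.trans he.symm) (hb.trans hω.1.symm) rfl
      (fun δ hδ => by
        rw [hQu δ (hδ.trans hb), sub_zero,
          walkFlow_at_cons hG hne hα.walk hω (hδ.trans hb)])
    have h₃ := M.pos_lt_pos_self (hb.trans (show _ = G.base (e, true) from he.symm)) hρ
    rw [if_neg (not_le.2 h₃), h₁] at h₂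
    rw [h₂]
    rcases hσ with rfl | rfl
    · rw [if_neg (by omega), if_pos (by omega)]
      simp
    · rw [if_pos (by omega), if_neg (by omega)]
      push_cast
      ring

end Embedding

end PlanarReach

namespace PlanarReach

/-! ### The planar comparison of extreme walks -/

namespace MultiDigraph

variable {V : Type u} {E : Type v} {G : MultiDigraph V E}

/-- A walk that leaves a set leaves it for a last time. -/
theorem IsWalk.exists_last_exit {R : Set V} {x y : V} {l : List E} (h : G.IsWalk x l y)
    (hx : x ∈ R) (hy : y ∉ R) :
    ∃ l₁ e l₂, l = l₁ ++ e :: l₂ ∧ G.src e ∈ R ∧ ∀ g ∈ e :: l₂, G.tgt g ∉ R := by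
  induction l using List.reverseRecOn generalizing y with
  | nil => exact absurd (show x = y from h) (by rintro rfl; exact hy hx)
  | append_singleton l e ih =>
    obtain ⟨z, h₁, rfl, h₂⟩ := isWalk_append.1 h
    obtain rfl : G.tgt e = y := h₂
    by_cases he : G.src e ∈ R
    · exact ⟨l, e, [], rfl, he, by simpa using hy⟩
    · obtain ⟨l₁, e', l₂, rfl, h₃, h₄⟩ := ih h₁ he
      refine ⟨l₁, e', l₂ ++ [e], by simp, h₃, fun g hg => ?_⟩
      rw [← List.cons_append, List.mem_append, List.mem_singleton] at hg
      rcases hg with hg | rfl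
      exacts [h₄ g hg, hy]

theorem IsWalk.eq_of_tgt_eq (hG : G.Acyclic) {x y : V} {l : List E} (h : G.IsWalk x l y)
    {e g : E} (he : e ∈ l) (hg : g ∈ l) (heg : G.tgt e = G.tgt g) : e = g := by
  obtain ⟨c, p, rfl, hc, hp⟩ := h.split_at he
  rcases List.mem_append.1 hg with hg | hg
  · have := (hc.reach_of_mem hg).2
    rw [← heg] at this
    exact absurd this (hG.not_reach_src e)
  · rcases List.mem_cons.1 hg with rfl | hg
    · rfl
    · have := (hp.reach_of_mem hg).1
      rw [heg] at this
      exact absurd this (hG.not_reach_src g)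

/-- The vertices of the walk `l` from `s`. -/
def WalkVertex (G : MultiDigraph V E) (s : V) (l : List E) (x : V) : Prop :=
  x = s ∨ ∃ g ∈ l, G.tgt g = x

theorem IsWalk.total {s z x y : V} {l : List E} (h : G.IsWalk s l z)
    (hx : G.WalkVertex s l x) (hy : G.WalkVertex s l y) : G.Reach x y ∨ G.Reach y x := by
  induction l generalizing s with
  | nil =>
    obtain rfl : x = s := by simpa [WalkVertex] using hx
    obtain rfl : y = x := by simpa [WalkVertex] using hy
    exact Or.inl .refl
  | cons e l ih =>
    have key : ∀ {x}, G.WalkVertex s (e :: l) x → x = s ∨ G.WalkVertex (G.tgt e) l x := by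
      rintro x (rfl | ⟨g, hg, rfl⟩)
      · exact Or.inl rfl
      · rcases List.mem_cons.1 hg with rfl | hg
        exacts [Or.inr (Or.inl rfl), Or.inr (Or.inr ⟨g, hg, rfl⟩)]
    have key' : ∀ {x}, G.WalkVertex (G.tgt e) l x → G.Reach s x := by
      rintro x (rfl | ⟨g, hg, rfl⟩)
      · exact h.1 ▸ reach_edge e
      · rw [← h.1]
        exact (reach_edge e).trans ((h.2.reach_of_mem hg).1.trans (reach_edge g))
    rcases key hx with hxs | hx' <;> rcases key hy with hys | hy'
    · rw [hxs, hys]; exact Or.inl .refl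
    · rw [hxs]; exact Or.inl (key' hy')
    · rw [hys]; exact Or.inr (key' hx')
    · exact ih h.2 hx' hy'

theorem Acyclic.wellFounded [Finite V] (hG : G.Acyclic) :
    WellFounded fun y x => Relation.TransGen G.Adj x y := by
  have : Std.Irrefl fun y x => Relation.TransGen G.Adj x y := ⟨hG⟩
  have : IsTrans V fun y x => Relation.TransGen G.Adj x y := ⟨fun _ _ _ h₁ h₂ => h₂.trans h₁⟩
  exact Finite.wellFounded_of_trans_of_irrefl _

theorem Acyclic.wellFounded_transGen [Finite V] (hG : G.Acyclic) :
    WellFounded (Relation.TransGen G.Adj) := by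
  have : Std.Irrefl (Relation.TransGen G.Adj) := ⟨hG⟩
  have : IsTrans V (Relation.TransGen G.Adj) := ⟨fun _ _ _ h₁ h₂ => h₁.trans h₂⟩
  exact Finite.wellFounded_of_trans_of_irrefl _

end MultiDigraph

namespace Embedding

open MultiDigraph

variable {V : Type u} {E : Type v} {G : MultiDigraph V E} {M : Embedding G}

/-- In an acyclic plane digraph, `u` reaches `w` if its extreme walks from `s` lie between those
of `w`, provided that the outer side of these walks and the face `f`, which `u` reaches, have the
same potential. -/
theorem reach_of_key_le [Finite V] [Finite E] (hG : G.Acyclic) (hs : G.SingleSource)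
    (hM : M.IsPlane) {r : Dart E} {p : E → Prop} {s u w a b : V} {f : M.Face} (hr : G.base r = s)
    (hpot : ∀ P Q h, G.IsWalk s P w → G.IsWalk s Q w → (∀ e ∈ P, p e) → (∀ e ∈ Q, p e) →
      M.IsWalkPotential P Q h → h (M.faceOf r) = h f)
    {A B : ℤ → List E} (hA : ∀ σ, M.IsMaxWalk σ r p s u (A σ))
    (hB : ∀ σ, M.IsMaxWalk σ r p s w (B σ))
    (hle : ∀ σ, σ = 1 ∨ σ = -1 → M.key σ r (A σ) ≤ M.key σ r (B σ))
    (ha : a ∈ M.faceVerts f) (hua : G.Reach u a)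
    (hb : b ∈ M.faceVerts f) (hwb : G.Reach w b) : G.Reach u w := by
  classical
  by_contra hn
  have hσ0 : ∀ σ : ℤ, σ = 1 ∨ σ = -1 → σ ≠ 0 := by rintro σ (rfl | rfl) <;> norm_num
  set R : Set V := {y | G.ReachVia p y w} with hR
  have huR : u ∉ R := fun h => hn h.reach
  -- all walks to `u` diverge from the extreme walks to `w`
  have hT : ∀ σ, σ = 1 ∨ σ = -1 → ∀ {y : V} {γ m : List E}, G.IsWalk s γ y → (∀ e ∈ γ, p e) →
      G.IsWalk y m u → (∀ e ∈ m, p e) → y ∉ R → M.Diverges σ r γ (B σ) := by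
    intro σ hσ y γ m hγ hpγ hm hpm hy
    have hle' : M.key σ r (γ ++ m) ≤ M.key σ r (B σ) := by
      refine ((hA σ).max _ (hγ.append hm) fun e he => ?_).trans (hle σ hσ)
      rcases List.mem_append.1 he with he | he
      exacts [hpγ e he, hpm e he]
    have hpre : ¬ ∃ m, B σ = γ ++ m := by
      rintro ⟨m', hm'⟩
      refine hy ⟨m', (hm' ▸ (hB σ).walk).right hγ, fun e he => (hB σ).prop e ?_⟩
      rw [hm']
      exact List.mem_append_right _ he
    have hle'' : M.key σ r γ ≤ M.key σ r (B σ) := by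
      refine le_trans ?_ hle'
      rcases eq_or_ne m [] with rfl | hm0
      · rw [List.append_nil]
      · exact (key_lt_append σ r γ hm0).le
    exact (diverges_or_prefix (hσ0 σ hσ) hr hγ (hB σ).walk hle'').resolve_right hpre
  -- The extreme walk to `u` starts in `R` and ends outside. Its last exit `e` has a tail that still
  -- reaches `w` within `p`, while all later vertices do not.
  obtain ⟨l₁, e, l₂, hl, heR, hexit⟩ := (hA 1).walk.exists_last_exit
    (R := R) ⟨B 1, (hB 1).walk, (hB 1).prop⟩ huR
  have hpA := (hA 1).prop
  rw [hl] at hpA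
  obtain ⟨_, hl₁, rfl, hl₂⟩ := isWalk_append.1 (hl ▸ (hA 1).walk)
  have hpe : p e := hpA e (by simp)
  have hpl₂ : ∀ g ∈ l₂, p g := fun g hg => hpA g (by simp [hg])
  have hteR : G.tgt e ∉ R := hexit e (by simp)
  have hteu : G.Reach (G.tgt e) u := hl₂.reach
  obtain ⟨ω', hω, hpω⟩ := heR
  cases ω' with
  -- If the exit is at `w` itself, `B 1` followed by `e` should have a smaller key than `B 1`, but
  -- an extension has a larger one.
  | nil =>
    obtain rfl : G.src e = w := hω
    have := hT 1 (Or.inl rfl) (hB 1).walk.snoc (fun g hg => by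
      rcases List.mem_append.1 hg with hg | hg
      · exact (hB 1).prop g hg
      · rw [List.mem_singleton.1 hg]; exact hpe) hl₂ hpl₂ hteR
    exact lt_asymm this.key_lt (key_lt_append _ _ _ (by simp))
  | cons o ω =>
  have hoR : G.tgt o ∈ R := ⟨ω, hω.2, fun g hg => hpω g (by simp [hg])⟩
  have hoe : (e, true) ≠ ((o, true) : Dart E) := by
    intro h
    obtain rfl : e = o := congrArg Prod.fst h
    exact hteR hoR
  have hreach : G.ReachVia p s (G.src e) := ⟨l₁, hl₁, fun g hg => hpA g (by simp [hg])⟩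
  choose α hα using fun σ => M.exists_isMaxWalk hG σ r hreach
  -- the continuation to `w` lies on the far side of `e`
  have hside : ∀ σ, σ = 1 ∨ σ = -1 →
      σ * M.pos (refDart r (α σ)) (e, true) ≤ σ * M.pos (refDart r (α σ)) (o, true) := by
    intro σ hσ
    by_contra hlt
    have hPw := (hα σ).walk.append hω
    have hpP : ∀ g ∈ α σ ++ o :: ω, p g := by
      intro g hg
      rcases List.mem_append.1 hg with hg | hg
      exacts [(hα σ).prop g hg, hpω g hg]
    obtain ⟨h, hh⟩ : ∃ h, M.IsWalkPotential (α σ ++ o :: ω) (B σ) h :=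
      M.exists_walk_potential hs hM hPw (hB σ).walk
    have hdiv := hT σ hσ (hα σ).walk.snoc (fun g hg => by
      rcases List.mem_append.1 hg with hg | hg
      · exact (hα σ).prop g hg
      · rw [List.mem_singleton.1 hg]; exact hpe) hl₂ hpl₂ hteR
    -- If `o` came before `e` in the order of `σ`, the edge `e` would start between two walks to
    -- `w`, where the potential differs by `σ` from the value at `r`.
    have h₁ := potential_between hG hσ hr (hα σ) (hB σ) hω rfl hdiv (not_le.1 hlt) hh
    obtain ⟨m, hm, -⟩ := hua.reachVia (p := fun _ => True) (fun _ _ => trivial)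
    have hflow : ∀ {Q : List E}, G.IsWalk s Q w → (∀ g ∈ Q, p g) → ∀ d : Dart E,
        G.base d ∈ Rᶜ → walkFlow Q d = 0 := by
      intro Q hQ hpQ d hd
      by_contra h0
      obtain ⟨c, q, rfl, -, hq⟩ := exists_prefix_of_walkFlow_ne_zero hQ h0
      exact hd ⟨q, hq, fun g hg => hpQ g (by simp [hg])⟩
    -- But from `e` one gets by way of `u` to the face `f` outside `R`, where neither walk to `w`
    -- has flow, and by `hpot` the potential of `f` equals that at `r`.
    have h₂ := IsWalkPotential.eq_of_walk (S := Rᶜ) hh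
      (fun d hd => by rw [hflow hPw hpP d hd, hflow (hB σ).walk (hB σ).prop d hd])
      (hl₂.append hm) ha hteR (fun g hg => by
        rcases List.mem_append.1 hg with hg | hg
        · exact hexit g (by simp [hg])
        · intro hgR
          exact hn ((hm.reach_of_mem hg).1.trans ((reach_edge g).trans hgR.reach)))
      (M.base_symm (e, false))
    rw [M.faceOf_symm, rev_mk, Bool.not_false, h₁,
      hpot _ _ h hPw (hB σ).walk hpP (hB σ).prop hh] at h₂
    rcases hσ with rfl | rfl <;> norm_num at h₂
  -- so `e` and `o` are separated by the two extreme walks to their common tail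
  have hb₁ := base_refDart hr (hα 1).walk
  have hb₂ := base_refDart hr (hα (-1)).walk
  have hp₁ : M.pos (refDart r (α 1)) (e, true) < M.pos (refDart r (α 1)) (o, true) := by
    refine lt_of_le_of_ne (by have := hside 1 (Or.inl rfl); omega) fun h => hoe ?_
    exact M.pos_injective hb₁ (hb₁.trans hω.1.symm) h
  have hp₂ : M.pos (refDart r (α (-1))) (o, true) < M.pos (refDart r (α (-1))) (e, true) := by
    refine lt_of_le_of_ne (by have := hside (-1) (Or.inr rfl); omega) fun h => hoe.symm ?_
    exact M.pos_injective (hb₂.trans hω.1.symm) hb₂ h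
  have hne : refDart r (α 1) ≠ refDart r (α (-1)) := by
    intro h
    rw [h] at hp₁
    exact lt_asymm hp₁ hp₂
  have hn₁ : α 1 ≠ [] := by
    intro h
    have h₁ := (hα 1).walk
    rw [h] at h₁
    have h₂ := (hα (-1)).walk
    rw [← show s = _ from h₁] at h₂
    rw [h, h₂.eq_nil hG] at hne
    exact hne rfl
  have hn₂ : α (-1) ≠ [] := by
    intro h
    have h₁ := (hα (-1)).walk
    rw [h] at h₁
    have h₂ := (hα 1).walk
    rw [← show s = _ from h₁] at h₂
    exact hn₁ (h₂.eq_nil hG)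
  obtain ⟨h, hh⟩ : ∃ h, M.IsWalkPotential (α 1) (α (-1)) h :=
    M.exists_walk_potential hs hM (hα 1).walk (hα (-1)).walk
  have hzero : ∀ {Q : List E}, G.IsWalk s Q (G.src e) → ∀ d : Dart E,
      G.base d ∈ {x | ¬ G.Reach x (G.src e)} → walkFlow Q d = 0 := by
    intro Q hQ d hd
    by_contra h0
    obtain ⟨c, q, rfl, -, hq⟩ := exists_prefix_of_walkFlow_ne_zero hQ h0
    exact hd hq.reach
  -- All flow is at vertices that reach the tail of `e`. By acyclicity no walk that leaves this tail
  -- meets such a vertex again, so it keeps its potential up to `f`.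
  have hout : ∀ g a, a ∈ M.faceVerts f → G.src g = G.src e → G.Reach (G.tgt g) a →
      h (M.faceOf (g, true)) = h f := by
    intro g a ha hg hga
    obtain ⟨m, hm, -⟩ := hga.reachVia (p := fun _ => True) (fun _ _ => trivial)
    have hback : ∀ {x}, G.Reach (G.tgt g) x → ¬ G.Reach x (G.src e) := fun h₁ h₂ => by
      rw [← hg] at h₂
      exact hG.not_reach_src g (h₁.trans h₂)
    have := IsWalkPotential.eq_of_walk (S := {x | ¬ G.Reach x (G.src e)}) hh
      (fun d hd => by rw [hzero (hα 1).walk d hd, hzero (hα (-1)).walk d hd]) hm ha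
      (hback .refl) (fun g' hg' => hback ((hm.reach_of_mem hg').1.trans (reach_edge g')))
      (M.base_symm (g, false))
    rwa [M.faceOf_symm, rev_mk, Bool.not_false] at this
  have he := hout e a ha rfl (hteu.trans hua)
  have ho := hout o b hb hω.1 (hoR.reach.trans hwb)
  have hturn : ∀ g, G.src g = G.src e → h (M.faceOf (g, true)) = _ := fun g hg =>
    M.turn_eq_of_two (K := fun d => h (M.faceOf d))
      (j := fun δ => walkFlow (α 1) δ - walkFlow (α (-1)) δ)
      (r := refDart r (α 1)) (g := (g, true)) (d₁ := refDart r (α (-1)))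
      (d₂ := refDart r (α 1)) hh.rot (hb₁.trans hg.symm) (hb₁.trans hb₂.symm) rfl
      (fun δ hδ => by
        rw [walkFlow_end hG hn₁ (hα 1).walk (hδ.trans hb₁) (r := r),
          walkFlow_end hG hn₂ (hα (-1)).walk (hδ.trans hb₁) (r := r)]
        ring)
  have hout_ne : ∀ g, (g, true) ≠ refDart r (α 1) ∧ (g, true) ≠ refDart r (α (-1)) := by
    intro g
    constructor
    · rcases List.eq_nil_or_concat' (α 1) with h₀ | ⟨l, x, h₀⟩
      · exact absurd h₀ hn₁
      · rw [h₀, refDart_concat]; simp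
    · rcases List.eq_nil_or_concat' (α (-1)) with h₀ | ⟨l, x, h₀⟩
      · exact absurd h₀ hn₂
      · rw [h₀, refDart_concat]; simp
  have hlast : ∀ g, G.src g = G.src e → M.pos (refDart r (α 1)) (g, true) <
      M.pos (refDart r (α 1)) (refDart r (α 1)) := fun g hg =>
    M.pos_lt_pos_self (hb₁.trans hg.symm) (hout_ne g).1
  have hsep := M.pos_separates (e := (e, true)) (o := (o, true)) (hb₁.trans hb₂.symm) hb₁
    (hb₁.trans hω.1.symm) hp₁ hp₂
  have hsep' : M.pos (refDart r (α 1)) (e, true) ≠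
      M.pos (refDart r (α 1)) (refDart r (α (-1))) := fun h =>
    (hout_ne e).2 (M.pos_injective hb₁ (hb₁.trans hb₂.symm) h)
  -- Between `e` and `o` the turn crosses the end of the other extreme walk, so the potentials there
  -- differ by 1, although both equal that of `f`.
  rw [hturn e rfl, if_neg (by omega), if_neg (not_le.2 (hlast e rfl))] at he
  rw [hturn o hω.1, if_pos hsep.2, if_neg (not_le.2 (hlast o hω.1))] at ho
  linarith

end Embedding

end PlanarReach

namespace PlanarReach

/-! ### The order at a single face, by cutting along a tight walk -/

namespace MultiDigraph

variable {V : Type u} {E : Type v} {G : MultiDigraph V E}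

/-- The edges in `H`, without those that enter the walk `L` from outside. -/
def AvoidsEntering (G : MultiDigraph V E) (H : E → Prop) (s : V) (L : List E) (e : E) : Prop :=
  H e ∧ (G.WalkVertex s L (G.tgt e) → e ∈ L)

/-- Whenever a walk from `s` enters `L`, its part so far can be replaced by the initial part of `L`
up to that vertex. -/
theorem reachVia_avoidsEntering {H : E → Prop} {s z x : V} {L : List E} (hL : G.IsWalk s L z)
    (hLH : ∀ e ∈ L, H e) (hx : G.Reach s x) (hH : ∀ e, G.Reach (G.tgt e) x → H e) :
    G.ReachVia (G.AvoidsEntering H s L) s x := by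
  induction hx with
  | refl => exact ReachVia.refl _
  | tail hy hyx ih =>
    obtain ⟨e, rfl, rfl⟩ := hyx
    by_cases he : G.WalkVertex s L (G.tgt e)
    · rcases he with he | ⟨g, hg, he⟩
      · rw [he]
        exact ReachVia.refl _
      · obtain ⟨c, p, rfl, hc, -⟩ := hL.split_at hg
        have hp : ∀ e ∈ c ++ [g], e ∈ c ++ g :: p := by
          intro e he
          rcases List.mem_append.1 he with he | he
          · simp [he]
          · simp [List.mem_singleton.1 he]
        rw [← he]
        exact ⟨c ++ [g], hc.snoc, fun e he => ⟨hLH e (hp e he), fun _ => hp e he⟩⟩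
    · exact (ih fun g hg => hH g (hg.trans (reach_edge e))).trans
        (ReachVia.single ⟨hH e .refl, fun h => absurd h he⟩)

/-- As `u` is not on `L`, a path either has an edge with head on `L`, and this head is the
intermediate vertex, or it has no such edge at all. -/
theorem reach_iff_through_or_avoiding {H : E → Prop} {s u w : V} {L : List E}
    (hu : ¬ G.WalkVertex s L u) (hH : ∀ e, G.Reach (G.tgt e) w → H e) (h : G.Reach u w) :
    (∃ x, G.WalkVertex s L x ∧ G.Reach u x ∧ G.Reach x w) ∨
      G.ReachVia (G.AvoidsEntering H s L) u w := by
  induction h using Relation.ReflTransGen.head_induction_on with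
  | refl => exact Or.inr (ReachVia.refl _)
  | head huy hyw ih =>
    obtain ⟨e, rfl, rfl⟩ := huy
    by_cases he : G.WalkVertex s L (G.tgt e)
    · exact Or.inl ⟨_, he, reach_edge e, hyw⟩
    · rcases ih he with ⟨x, hx, h₁, h₂⟩ | h
      · exact Or.inl ⟨x, hx, (reach_edge e).trans h₁, h₂⟩
      · exact Or.inr ((ReachVia.single ⟨hH e hyw, fun h => absurd h he⟩).trans h)

/-- Reachability through a chain of vertices is decided by counting. -/
theorem card_lt_card_iff_through [Finite V] {C : Set V}
    (hC : ∀ x ∈ C, ∀ y ∈ C, G.Reach x y ∨ G.Reach y x) (u w : V) :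
    {x ∈ C | ¬ G.Reach u x}.ncard + 1 ≤ {x ∈ C | G.Reach x w}.ncard ↔
      ∃ x ∈ C, G.Reach u x ∧ G.Reach x w := by
  constructor
  · intro h
    by_contra! hn
    have : {x ∈ C | G.Reach x w} ⊆ {x ∈ C | ¬ G.Reach u x} :=
      fun x hx => ⟨hx.1, fun h => hn x hx.1 h hx.2⟩
    have := Set.ncard_le_ncard this
    omega
  · rintro ⟨x, hx, h₁, h₂⟩
    -- In the chain the vertices missed by `u` all reach `x`, hence `w`, and `x` is one more vertex
    -- that reaches `w`.
    refine Nat.succ_le_of_lt (Set.ncard_lt_ncard ⟨fun y hy => ⟨hy.1, ?_⟩, fun h => ?_⟩)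
    · rcases hC x hx y hy.1 with h | h
      · exact absurd (h₁.trans h) hy.2
      · exact h.trans h₂
    · exact (h ⟨hx, h₂⟩ : x ∈ {x ∈ C | ¬ G.Reach u x}).2 h₁

end MultiDigraph

/-- Ranks of the elements of a finite type in a linear order of their keys. -/
theorem ncard_key_le_iff {V α : Type*} [Finite V] [LinearOrder α] (key : V → α) (u w : V) :
    {z | key z ≤ key u}.ncard ≤ {z | key z ≤ key w}.ncard ↔ key u ≤ key w := by
  constructor
  · intro h
    by_contra hlt
    rw [not_le] at hlt
    refine absurd (Set.ncard_lt_ncard (s := {z | key z ≤ key w}) (t := {z | key z ≤ key u})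
      ⟨fun z hz => le_trans hz hlt.le, fun hsub => ?_⟩) (not_lt.2 h)
    exact absurd (hsub (le_refl (key u))) (not_le.2 hlt)
  · exact fun h => Set.ncard_le_ncard fun z hz => le_trans hz h

namespace Embedding

open MultiDigraph

variable {V : Type u} {E : Type v} {G : MultiDigraph V E} (M : Embedding G)

/-- Consecutive edges of the walk `L` take the first turn among the edges in `H`. -/
def IsTight (H : E → Prop) (L : List E) : Prop :=
  L.IsChain fun e e' => ∀ g, H g → G.src g = G.tgt e →
    M.pos (e, false) (e', true) ≤ M.pos (e, false) (g, true)

/-- The walk is continued greedily by the first turn within `H`. Acyclicity ends it, and it can only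
end where no edge of `H` goes out; for `H` from a face, this is a vertex of the face. -/
theorem exists_tight_walk [Finite V] [Finite E] (hG : G.Acyclic) (H : E → Prop) (e : E)
    (he : H e) : ∃ l z, G.IsWalk (G.src e) (e :: l) z ∧ (∀ g ∈ e :: l, H g) ∧
      M.IsTight H (e :: l) ∧ ∀ g, H g → G.src g ≠ z := by
  induction hv : G.tgt e using hG.wellFounded.induction generalizing e with
  | _ v ih =>
  subst hv
  by_cases hex : ∃ g, H g ∧ G.src g = G.tgt e
  · obtain ⟨g, ⟨hg, hge⟩, hmin⟩ := Set.exists_min_image {g | H g ∧ G.src g = G.tgt e}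
      (fun g => M.pos (e, false) (g, true)) (Set.toFinite _) hex
    obtain ⟨l, z, h₁, h₂, h₃, h₄⟩ := ih (G.tgt g) (.single ⟨g, hge, rfl⟩) g hg rfl
    refine ⟨g :: l, z, ⟨rfl, hge ▸ h₁⟩, ?_, ?_, h₄⟩
    · intro a ha
      rcases List.mem_cons.1 ha with rfl | ha
      exacts [he, h₂ a ha]
    · exact List.isChain_cons_cons.2 ⟨fun a ha hae => hmin a ⟨ha, hae⟩, h₃⟩
  · push Not at hex
    exact ⟨[], _, ⟨rfl, rfl⟩, by simpa using he, List.isChain_singleton _, hex⟩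

variable {M}

/-- Along the free side of a tight walk, potentials of walks that do not enter it are constant. -/
theorem IsWalkPotential.eq_of_tight [Finite E] (hG : G.Acyclic) {H : E → Prop} {s z w : V}
    {L P Q : List E} {h : M.Face → ℚ} {f : M.Face} (hL : G.IsWalk s L z)
    (hzH : ∀ g, H g → G.src g ≠ z) (hzf : z ∈ M.faceVerts f) (hw : ¬ G.WalkVertex s L w)
    (hP : G.IsWalk s P w) (hPp : ∀ e ∈ P, G.AvoidsEntering H s L e) (hQ : G.IsWalk s Q w)
    (hQp : ∀ e ∈ Q, G.AvoidsEntering H s L e) (hh : M.IsWalkPotential P Q h)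
    {L₀ l : List E} {e : E} (hLe : L = L₀ ++ e :: l) (ht : M.IsTight H (e :: l)) :
    h (M.faceOf (e, false)) = h f := by
  induction l generalizing L₀ e with
  | nil =>
    obtain ⟨_, -, -, hez⟩ := isWalk_append.1 (hLe ▸ hL)
    obtain rfl : G.tgt e = z := hez
    -- There is no flow at the end of `L`: a walk that arrives there would have to end there, but
    -- `w` is not on `L`, or to leave by an edge of `H`.
    have hezL : ∀ d : Dart E, G.base d = G.tgt e → ∀ {R : List E}, G.IsWalk s R w →
        (∀ e ∈ R, G.AvoidsEntering H s L e) → walkFlow R d = 0 := by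
      rintro ⟨g, b⟩ hd R hR hRp
      refine walkFlow_eq_zero fun hg => ?_
      cases b with
      | true => exact hzH g (hRp g hg).1 hd
      | false =>
        change G.tgt g = G.tgt e at hd
        obtain ⟨c, p, rfl, -, hp⟩ := hR.split_at hg
        cases p with
        | nil =>
          obtain rfl : G.tgt g = w := hp
          exact hw (Or.inr ⟨e, by simp [hLe], hd.symm⟩)
        | cons g' p => exact hzH g' (hRp g' (by simp)).1 (hp.1.trans hd)
    exact hh.eq_of_walk (S := {G.tgt e}) (l := []) (fun d hd => by
      rw [hezL d hd hP hPp, hezL d hd hQ hQp]) rfl hzf rfl (by simp) rfl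
  | cons e' l ih =>
    rw [← ih (L₀ := L₀ ++ [e]) (by simp [hLe]) (List.isChain_cons_cons.1 ht).2]
    have htight := (List.isChain_cons_cons.1 ht).1
    have hee' : G.src e' = G.tgt e := by
      obtain ⟨_, -, -, h₁, -⟩ := isWalk_append.1 (hLe ▸ hL)
      exact h₁
    have hb : G.base ((e, false) : Dart E) = G.base ((e', true) : Dart E) := hee'.symm
    have h₁ := M.turn_eq (K := fun d => h (M.faceOf d))
      (j := fun d => walkFlow P d - walkFlow Q d) hh.rot hb
    rw [Finset.sum_range_succ, Finset.sum_eq_zero, M.pow_pos_add_one hb, zero_add, hh] at h₁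
    · rw [rev_mk, Bool.not_true] at h₁
      linarith
    -- Darts strictly between the arriving dart of `e` and `e'` carry no flow: outgoing ones are not
    -- in `H` by tightness, and ingoing ones would enter `L` from outside.
    intro i hi
    rw [Finset.mem_range] at hi
    have hzero : ∀ {R : List E}, (∀ e ∈ R, G.AvoidsEntering H s L e) →
        walkFlow R ((M.rot ^ (i + 1)) (e, false)) = 0 := by
      intro R hRp
      refine walkFlow_eq_zero fun hg => ?_
      obtain ⟨⟨g, b⟩, hd⟩ : ∃ d, (M.rot ^ (i + 1)) (e, false) = d := ⟨_, rfl⟩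
      have hbase : G.base (g, b) = G.tgt e := by rw [← hd, M.base_pow]; rfl
      rw [hd] at hg
      have hpos := M.pos_le hd
      cases b with
      | true =>
        have := htight g (hRp g hg).1 hbase
        omega
      | false =>
        change G.tgt g = G.tgt e at hbase
        have heL : e ∈ L := by simp [hLe]
        have hgL := (hRp g hg).2 (Or.inr ⟨e, heL, hbase.symm⟩)
        obtain rfl := hL.eq_of_tgt_eq hG heL hgL hbase.symm
        have := M.pos_lt_pos_self hb (by simp)
        omega
    rw [hzero hPp, hzero hQp, sub_zero]

variable (M)

/-- Reachability among the vertices that reach the face `f` is decided by comparing three pairs of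
numbers. -/
theorem exists_face_order [Finite V] [Finite E] (hG : G.Acyclic) (hs : G.SingleSource)
    (hM : M.IsPlane) (f : M.Face) :
    ∃ a b : Fin 3 → V → ℕ, (∀ i x, 1 ≤ a i x ∧ a i x ≤ Nat.card V + 1 ∧ b i x ≤ Nat.card V) ∧
      ∀ u ∈ (M.bc f).verts, ∀ w ∈ (M.bc f).verts,
        (G.Reach u w ↔ a 0 u ≤ b 0 w ∨ a 1 u ≤ b 1 w ∧ a 2 u ≤ b 2 w) := by
  classical
  obtain ⟨s, hs'⟩ := id hs
  have hcard : ∀ S : Set V, S.ncard ≤ Nat.card V := fun S => Set.ncard_le_card S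
  set H : E → Prop := fun e => G.tgt e ∈ (M.bc f).verts with hH
  by_cases hex : ∃ e, H e ∧ G.src e = s
  swap
  -- In this degenerate case no edge of the closure leaves `s`, and constants do.
  · have hall : ∀ u ∈ (M.bc f).verts, u = s := by
      rintro u ⟨a, ha, hua⟩
      rcases Relation.ReflTransGen.cases_head (hs' u) with h | ⟨y, ⟨e, he, rfl⟩, hy⟩
      · exact h.symm
      · exact absurd ⟨e, ⟨a, ha, hy.trans hua⟩, he⟩ hex
    refine ⟨fun _ _ => 1, fun _ _ => 1, fun i x => ⟨le_rfl, Nat.le_add_left 1 _, ?_⟩,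
      fun u hu w hw => ?_⟩
    · have : Nonempty V := ⟨s⟩
      exact Nat.card_pos
    · rw [hall u hu, hall w hw]
      simp [MultiDigraph.Reach, Relation.ReflTransGen.refl]
  obtain ⟨e₀, he₀, rfl⟩ := hex
  obtain ⟨l, z, hL, hLH, htight, hz⟩ := M.exists_tight_walk hG H e₀ he₀
  set s := G.src e₀
  set L := e₀ :: l with hLdef
  have hzf : z ∈ M.faceVerts f := by
    obtain ⟨a, ha, hza⟩ : z ∈ (M.bc f).verts := by
      rcases List.eq_nil_or_concat' L with h | ⟨L', g, h⟩
      · simp [hLdef] at h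
      · rw [h] at hL hLH
        obtain ⟨_, -, -, h₁⟩ := isWalk_append.1 hL
        rw [← show G.tgt g = z from h₁]
        exact hLH g (by simp)
    rcases Relation.ReflTransGen.cases_head hza with h | ⟨y, ⟨e, he, rfl⟩, hy⟩
    · exact h ▸ ha
    · exact absurd he (hz e ⟨a, ha, hy⟩)
  -- With this reference dart the face at `r` is the one to the right of the first edge of `L`, so
  -- that `eq_of_tight` yields the hypothesis `hpot` of `reach_of_key_le`.
  set r : Dart E := M.rot.symm (e₀, true)
  have hr : G.base r = s := M.base_symm _
  set p := G.AvoidsEntering H s L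
  have hHreach : ∀ w ∈ (M.bc f).verts, ∀ e, G.Reach (G.tgt e) w → H e := by
    rintro w ⟨a, ha, hwa⟩ e he
    exact ⟨a, ha, he.trans hwa⟩
  have hvia : ∀ u ∈ (M.bc f).verts, G.ReachVia p s u := fun u hu =>
    reachVia_avoidsEntering hL hLH (hs' u) (hHreach u hu)
  choose! A hA using fun (σ : ℤ) (u : V) (hu : u ∈ (M.bc f).verts) =>
    M.exists_isMaxWalk hG σ r (hvia u hu)
  set C : Set V := {x | G.WalkVertex s L x}
  have hC : ∀ x ∈ C, ∀ y ∈ C, G.Reach x y ∨ G.Reach y x := fun x hx y hy => hL.total hx hy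
  set rank : ℤ → V → ℕ := fun σ u => {x | M.key σ r (A σ x) ≤ M.key σ r (A σ u)}.ncard with hrank
  have hrank_pos : ∀ σ u, 1 ≤ rank σ u := fun σ u =>
    (Set.ncard_pos (Set.toFinite _)).2 ⟨u, le_refl (M.key σ r (A σ u))⟩
  -- Ranks lie between 1 and `|V|`. The values `|V| + 1` and 0 therefore make the last two
  -- comparisons fail if `u` or `w` is on `L`, where the first pair decides alone.
  refine ⟨![fun u => {x ∈ C | ¬ G.Reach u x}.ncard + 1,
      fun u => if u ∈ C then Nat.card V + 1 else rank 1 u,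
      fun u => if u ∈ C then Nat.card V + 1 else rank (-1) u],
    ![fun w => {x ∈ C | G.Reach x w}.ncard, fun w => if w ∈ C then 0 else rank 1 w,
      fun w => if w ∈ C then 0 else rank (-1) w], fun i x => ?_, fun u hu w hw => ?_⟩
  · fin_cases i
    · exact ⟨Nat.le_add_left _ _, Nat.succ_le_succ (hcard _), hcard _⟩
    · by_cases hx : x ∈ C
      · simp [hx]
      · simpa [hx] using ⟨hrank_pos 1 x, (hcard _).trans (Nat.le_succ _), hcard _⟩
    · by_cases hx : x ∈ C
      · simp [hx]
      · simpa [hx] using ⟨hrank_pos (-1) x, (hcard _).trans (Nat.le_succ _), hcard _⟩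
  simp only [Matrix.cons_val_zero, Matrix.cons_val_one, Matrix.cons_val, Fin.isValue]
  rw [card_lt_card_iff_through hC u w]
  constructor
  · intro huw
    by_cases huC : u ∈ C
    · exact Or.inl ⟨u, huC, .refl, huw⟩
    by_cases hwC : w ∈ C
    · exact Or.inl ⟨w, hwC, huw, .refl⟩
    rcases reach_iff_through_or_avoiding huC (hHreach w hw) huw with h | ⟨m, hm, hmp⟩
    · exact Or.inl h
    · right
      simp only [huC, hwC, if_false, hrank, ncard_key_le_iff]
      have : ∀ σ, M.key σ r (A σ u) ≤ M.key σ r (A σ w) := by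
        intro σ
        refine le_trans ?_ ((hA σ w hw).max (A σ u ++ m) ((hA σ u hu).walk.append hm) ?_)
        · rcases eq_or_ne m [] with rfl | h
          · rw [List.append_nil]
          · exact (key_lt_append σ r _ h).le
        · intro e he
          rcases List.mem_append.1 he with he | he
          exacts [(hA σ u hu).prop e he, hmp e he]
      exact ⟨this 1, this (-1)⟩
  · rintro (⟨x, -, h₁, h₂⟩ | h)
    · exact h₁.trans h₂
    · by_cases huC : u ∈ C
      · exfalso
        have : rank 1 w ≤ Nat.card V := hcard _
        by_cases hwC : w ∈ C
        · simp [huC, hwC] at h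
        · simp only [huC, hwC, if_true, if_false] at h
          omega
      by_cases hwC : w ∈ C
      · exfalso
        have := hrank_pos 1 u
        simp only [huC, hwC, if_true, if_false] at h
        omega
      simp only [huC, hwC, if_false, hrank, ncard_key_le_iff] at h
      obtain ⟨a, ha, hua⟩ := hu
      obtain ⟨b, hb, hwb⟩ := hw
      refine reach_of_key_le hG hs hM (p := p) hr (fun P Q h hP hQ hPp hQp hh => ?_)
        (fun σ => hA σ u ⟨a, ha, hua⟩) (fun σ => hA σ w ⟨b, hb, hwb⟩) ?_ ha hua hb hwb
      · rw [M.faceOf_symm, rev_mk, Bool.not_true]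
        exact hh.eq_of_tight hG hL hz hzf hwC hP hPp hQ hQp (L₀ := []) rfl htight
      · rintro σ (rfl | rfl)
        exacts [h.1, h.2]

end Embedding

end PlanarReach

namespace PlanarReach

/-! ### Dual components, boundary corners of a frame, and gates -/

open MultiDigraph

namespace Embedding

variable {V : Type u} {E : Type v} {G : MultiDigraph V E} {M : Embedding G} {H : G.Subgraph}

theorem base_eq_src_or_tgt (d : Dart E) : G.base d = G.src d.1 ∨ G.base d = G.tgt d.1 := by
  obtain ⟨e, b⟩ := d
  cases b
  exacts [Or.inr rfl, Or.inl rfl]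

theorem base_mem_of_edge_mem {d : Dart E} (hd : d.1 ∈ H.edges) : G.base d ∈ H.verts := by
  rcases base_eq_src_or_tgt (G := G) d with h | h <;> rw [h]
  exacts [H.src_mem _ hd, H.tgt_mem _ hd]

theorem DualAdj.symm {f g : M.Face} (h : M.DualAdj H f g) : M.DualAdj H g f := by
  obtain ⟨d, hd, rfl, rfl⟩ := h
  exact ⟨Dart.rev d, hd, rfl, by rw [rev_rev]⟩

theorem dualReach_symm {f g : M.Face} (h : Relation.ReflTransGen (M.DualAdj H) f g) :
    Relation.ReflTransGen (M.DualAdj H) g f := by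
  induction h with
  | refl => exact .refl
  | tail _ h ih => exact .head h.symm ih

theorem mem_dualComponent_congr {f g g' : M.Face} (h : Relation.ReflTransGen (M.DualAdj H) g g') :
    g ∈ M.dualComponent H f ↔ g' ∈ M.dualComponent H f :=
  ⟨fun hg => hg.trans h, fun hg => hg.trans (dualReach_symm h)⟩

theorem dualReach_rot {d : Dart E} (hd : (M.rot d).1 ∉ H.edges) :
    Relation.ReflTransGen (M.DualAdj H) (M.faceOf d) (M.faceOf (M.rot d)) := by
  refine .single (DualAdj.symm ⟨M.rot d, hd, rfl, ?_⟩)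
  rw [← M.faceOf_symm, Equiv.symm_apply_apply]

theorem dualReach_pow {d : Dart E} {k : ℕ}
    (h : ∀ j, 0 < j → j ≤ k → ((M.rot ^ j) d).1 ∉ H.edges) :
    Relation.ReflTransGen (M.DualAdj H) (M.faceOf d) (M.faceOf ((M.rot ^ k) d)) := by
  induction k with
  | zero => exact .refl
  | succ k ih =>
    refine (ih fun j h₁ h₂ => h j h₁ (by omega)).trans ?_
    have := h (k + 1) (by omega) le_rfl
    rw [pow_succ', Equiv.Perm.mul_apply] at this ⊢
    exact dualReach_rot this

/-- The faces around a vertex outside `H` are connected. -/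
theorem dualReach_of_not_mem [Finite E] {x : V} (hx : x ∉ H.verts) {f g : M.Face}
    (hf : x ∈ M.faceVerts f) (hg : x ∈ M.faceVerts g) :
    Relation.ReflTransGen (M.DualAdj H) f g := by
  rcases hf with ⟨d, hd, rfl⟩ | ⟨h, rfl⟩ <;> rcases hg with ⟨d', hd', rfl⟩ | ⟨h', rfl⟩
  · obtain ⟨k, rfl⟩ := M.exists_pow_eq (hd.trans hd'.symm)
    refine dualReach_pow fun j _ _ hj => hx ?_
    rw [← hd, ← M.base_pow j]
    exact base_mem_of_edge_mem hj
  · exact absurd hd (h' d)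
  · exact absurd hd' (h d')
  · exact .refl

/-- The faces around a vertex outside a backward closed subgraph are connected to every face that
the vertex reaches. -/
theorem dualReach_of_mem_bc [Finite E] (hH : H.BackwardClosed) {x : V} (hx : x ∉ H.verts)
    {f g : M.Face} (hf : x ∈ (M.bc f).verts) (hg : x ∈ M.faceVerts g) :
    Relation.ReflTransGen (M.DualAdj H) g f := by
  obtain ⟨a, ha, hxa⟩ := hf
  induction hxa using Relation.ReflTransGen.head_induction_on generalizing g with
  | refl => exact dualReach_of_not_mem hx hg ha
  | head h _ ih =>
    obtain ⟨e, rfl, rfl⟩ := h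
    refine (dualReach_of_not_mem hx hg (Or.inl ⟨(e, true), rfl, rfl⟩)).trans
      (ih (fun h => hx (H.src_mem e (hH e h)))
        (Or.inl ⟨M.rot.symm (e, false), M.base_symm _, ?_⟩))
    rw [M.faceOf_symm, rev_mk, Bool.not_false]

/-! ### Corners -/

theorem exists_next_corner [Finite E] {d : Dart E} (hd : d.1 ∈ H.edges) :
    ∃ d', M.IsCorner H d d' := by
  classical
  have hex : ∃ k, 0 < k ∧ ((M.rot ^ k) d).1 ∈ H.edges :=
    ⟨orderOf M.rot, orderOf_pos _, by simpa [pow_orderOf_eq_one] using hd⟩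
  exact ⟨_, hd, (Nat.find_spec hex).2, Nat.find hex, (Nat.find_spec hex).1, rfl,
    fun j h₁ h₂ h₃ => Nat.find_min hex h₂ ⟨h₁, h₃⟩⟩

/-- The dart `g` need not belong to `H`; this finds the corner of `H` in which an edge leaves `H`. A
full turn is added in the proof to make the number of steps positive. -/
theorem exists_prev_dart [Finite E] {g d₀ : Dart E} (hd₀ : d₀.1 ∈ H.edges)
    (hb : G.base d₀ = G.base g) : ∃ (d : Dart E) (k : ℕ), d.1 ∈ H.edges ∧ 0 < k ∧
      (M.rot ^ k) d = g ∧ ∀ j, 0 < j → j < k → ((M.rot ^ j) d).1 ∉ H.edges := by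
  classical
  have hex : ∃ k, 0 < k ∧ ∃ d : Dart E, d.1 ∈ H.edges ∧ (M.rot ^ k) d = g := by
    obtain ⟨k, hk⟩ := M.exists_pow_eq hb
    refine ⟨k + orderOf M.rot, by have := orderOf_pos M.rot; omega, d₀, hd₀, ?_⟩
    rw [pow_add, pow_orderOf_eq_one, mul_one, hk]
  obtain ⟨h₁, d, h₂, h₃⟩ := Nat.find_spec hex
  refine ⟨d, _, h₂, h₁, h₃, fun j hj₁ hj₂ hj₃ => ?_⟩
  refine Nat.find_min hex (m := Nat.find hex - j) (by omega) ⟨by omega, _, hj₃, ?_⟩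
  rw [← Equiv.Perm.mul_apply, ← pow_add, Nat.sub_add_cancel hj₂.le, h₃]

theorem IsCorner.next_unique {d d₁ d₂ : Dart E} (h₁ : M.IsCorner H d d₁)
    (h₂ : M.IsCorner H d d₂) : d₁ = d₂ := by
  obtain ⟨-, hd₁, k₁, hk₁, rfl, hm₁⟩ := h₁
  obtain ⟨-, hd₂, k₂, hk₂, rfl, hm₂⟩ := h₂
  rcases lt_trichotomy k₁ k₂ with h | h | h
  · exact absurd hd₁ (hm₂ _ hk₁ h)
  · rw [h]
  · exact absurd hd₂ (hm₁ _ hk₂ h)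

theorem IsCorner.prev_unique {d d₁ d₂ : Dart E} (h₁ : M.IsCorner H d₁ d)
    (h₂ : M.IsCorner H d₂ d) : d₁ = d₂ := by
  have key : ∀ {d₁ d₂ : Dart E} {k₁ k₂ : ℕ}, d₁.1 ∈ H.edges → (M.rot ^ k₁) d₁ = d →
      0 < k₁ → (M.rot ^ k₂) d₂ = d → (∀ j, 0 < j → j < k₂ → ((M.rot ^ j) d₂).1 ∉ H.edges) →
      ¬ k₁ < k₂ := by
    intro d₁ d₂ k₁ k₂ hd₁ h₁ hk₁ h₂ hm h
    refine hm (k₂ - k₁) (by omega) (by omega) ?_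
    have : (M.rot ^ k₁) ((M.rot ^ (k₂ - k₁)) d₂) = (M.rot ^ k₁) d₁ := by
      rw [← Equiv.Perm.mul_apply, ← pow_add, Nat.add_sub_cancel' h.le, h₁, h₂]
    rwa [(M.rot ^ k₁).injective this]
  obtain ⟨hd₁, -, k₁, hk₁, e₁, hm₁⟩ := h₁
  obtain ⟨hd₂, -, k₂, hk₂, e₂, hm₂⟩ := h₂
  have hk : k₁ = k₂ := le_antisymm (not_lt.1 (key hd₂ e₂ hk₂ e₁ hm₁))
    (not_lt.1 (key hd₁ e₁ hk₁ e₂ hm₂))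
  subst hk
  exact (M.rot ^ k₁).injective (e₁.trans e₂.symm)

theorem IsCorner.base_eq {d d' : Dart E} (h : M.IsCorner H d d') : G.base d' = G.base d := by
  obtain ⟨-, -, k, -, rfl, -⟩ := h
  exact M.base_pow k d

/-- The darts inside the corner are not in `H`, so their dual edges connect all faces from the left
of `d` to the right of `d'`. -/
theorem IsCorner.dualReach {d d' : Dart E} (h : M.IsCorner H d d') :
    Relation.ReflTransGen (M.DualAdj H) (M.faceOf d) (M.faceOf (Dart.rev d')) := by
  obtain ⟨-, -, k, hk, rfl, hm⟩ := h
  have := dualReach_pow (M := M) (H := H) (d := d) (k := k - 1)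
    fun j h₁ h₂ => hm j h₁ (by omega)
  rw [← M.faceOf_symm]
  convert this using 2
  rw [Equiv.symm_apply_eq, ← Equiv.Perm.mul_apply, ← pow_succ', Nat.sub_add_cancel hk]

/-- The corners of `H` on the boundary of the face of `H` that is the component of `f₀`. -/
def boundaryCorners (M : Embedding G) (H : G.Subgraph) (f₀ : M.Face) : Set (Dart E × Dart E) :=
  {c | M.IsCorner H c.1 c.2 ∧ M.faceOf c.1 ∈ M.dualComponent H f₀}

/-- From a boundary corner along the edge of its second dart, or of its first dart, if this is
outgoing, to the next boundary corner. -/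
def CornerStep (M : Embedding G) (H : G.Subgraph) (f₀ : M.Face) (fwd : Bool)
    (c c' : Dart E × Dart E) : Prop :=
  c ∈ M.boundaryCorners H f₀ ∧ c' ∈ M.boundaryCorners H f₀ ∧
    if fwd then c.2.2 = true ∧ c'.1 = Dart.rev c.2 else c.1.2 = true ∧ c'.2 = Dart.rev c.1

variable {f₀ : M.Face} {fwd : Bool} {c c' c₁ c₂ : Dart E × Dart E}

/-- Given the edge that is followed, the neighbouring corner is determined by one of its darts. So
the steps from a source corner in one direction form a single run, whose vertices are a chain for
reachability. -/
theorem CornerStep.unique (h₁ : M.CornerStep H f₀ fwd c c₁) (h₂ : M.CornerStep H f₀ fwd c c₂) :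
    c₁ = c₂ := by
  obtain ⟨-, ⟨h₁, -⟩, h₁'⟩ := h₁
  obtain ⟨-, ⟨h₂, -⟩, h₂'⟩ := h₂
  cases fwd with
  | true =>
    have h := h₁'.2.trans h₂'.2.symm
    refine Prod.ext h ?_
    rw [h] at h₁
    exact h₁.next_unique h₂
  | false =>
    have h := h₁'.2.trans h₂'.2.symm
    refine Prod.ext ?_ h
    rw [h] at h₁
    exact h₁.prev_unique h₂

theorem CornerStep.adj (h : M.CornerStep H f₀ fwd c c') : G.Adj (G.base c.1) (G.base c'.1) := by
  obtain ⟨⟨h₁, -⟩, ⟨h₂, -⟩, h⟩ := h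
  obtain ⟨⟨e₁, b₁⟩, ⟨e₂, b₂⟩⟩ := c
  cases fwd with
  | true =>
    obtain ⟨rfl, h⟩ : b₂ = true ∧ _ := h
    rw [← h₁.base_eq, h]
    exact ⟨e₂, rfl, rfl⟩
  | false =>
    obtain ⟨rfl, h⟩ : b₁ = true ∧ _ := h
    rw [← h₂.base_eq, h]
    exact ⟨e₁, rfl, rfl⟩

theorem reach_of_cornerSteps (h : Relation.ReflTransGen (M.CornerStep H f₀ fwd) c c') :
    G.Reach (G.base c.1) (G.base c'.1) := by
  induction h with
  | refl => exact .refl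
  | tail _ h ih => exact ih.tail h.adj

/-- Every boundary corner is on a directed boundary path from a source corner. -/
theorem exists_source_corner [Finite V] [Finite E] (hG : G.Acyclic)
    (hc : c ∈ M.boundaryCorners H f₀) : ∃ fwd, ∃ c₀ ∈ M.sourceCorners H (M.dualComponent H f₀),
      Relation.ReflTransGen (M.CornerStep H f₀ fwd) c₀ c := by
  have before : ∀ {c : Dart E × Dart E}, c ∈ M.boundaryCorners H f₀ → c.1.2 = false →
      ∃ c₁, c₁.2.2 = true ∧ M.CornerStep H f₀ true c₁ c := by
    rintro ⟨⟨e, b⟩, d'⟩ hc hb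
    obtain rfl : b = false := hb
    obtain ⟨d, k, hd, hk, hg, hm⟩ := exists_prev_dart (M := M) (g := (e, true))
      (d₀ := (e, true)) hc.1.1 rfl
    have hcor : M.IsCorner H d (e, true) := ⟨hd, hc.1.1, k, hk, hg, hm⟩
    exact ⟨(d, (e, true)), rfl, ⟨hcor, (mem_dualComponent_congr hcor.dualReach).2 hc.2⟩, hc,
      rfl, rfl⟩
  have after : ∀ {c : Dart E × Dart E}, c ∈ M.boundaryCorners H f₀ → c.2.2 = false →
      ∃ c₁, c₁.1.2 = true ∧ M.CornerStep H f₀ false c₁ c := by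
    rintro ⟨d, ⟨e, b⟩⟩ hc hb
    obtain rfl : b = false := hb
    obtain ⟨d', hcor⟩ := exists_next_corner (M := M) (H := H) (d := (e, true)) hc.1.2.1
    exact ⟨((e, true), d'), rfl, ⟨hcor, (mem_dualComponent_congr hc.1.dualReach).1 hc.2⟩, hc,
      rfl, rfl⟩
  -- Each step back goes against an edge. By acyclicity this stops, and it can stop only at a source
  -- corner.
  have forward : ∀ x (c : Dart E × Dart E), G.base c.1 = x → c ∈ M.boundaryCorners H f₀ →
      c.2.2 = true → ∃ c₀ ∈ M.sourceCorners H (M.dualComponent H f₀),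
        Relation.ReflTransGen (M.CornerStep H f₀ true) c₀ c := by
    intro x
    induction x using hG.wellFounded_transGen.induction with
    | _ x ih =>
    rintro c rfl hc hout
    cases hin : c.1.2 with
    | true => exact ⟨c, ⟨hc.1, hc.2, hin, hout⟩, .refl⟩
    | false =>
      obtain ⟨c₁, h₁, hstep⟩ := before hc hin
      obtain ⟨c₀, h₀, h₂⟩ := ih _ (.single hstep.adj) c₁ rfl hstep.1 h₁
      exact ⟨c₀, h₀, h₂.tail hstep⟩
  have backward : ∀ x (c : Dart E × Dart E), G.base c.1 = x → c ∈ M.boundaryCorners H f₀ →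
      c.1.2 = true → ∃ c₀ ∈ M.sourceCorners H (M.dualComponent H f₀),
        Relation.ReflTransGen (M.CornerStep H f₀ false) c₀ c := by
    intro x
    induction x using hG.wellFounded_transGen.induction with
    | _ x ih =>
    rintro c rfl hc hin
    cases hout : c.2.2 with
    | true => exact ⟨c, ⟨hc.1, hc.2, hin, hout⟩, .refl⟩
    | false =>
      obtain ⟨c₁, h₁, hstep⟩ := after hc hout
      obtain ⟨c₀, h₀, h₂⟩ := ih _ (.single hstep.adj) c₁ rfl hstep.1 h₁
      exact ⟨c₀, h₀, h₂.tail hstep⟩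
  cases hin : c.1.2 with
  | true => exact ⟨false, backward _ c rfl hc hin⟩
  | false =>
    obtain ⟨c₁, h₁, hstep⟩ := before hc hin
    obtain ⟨c₀, h₀, h₂⟩ := forward _ c₁ rfl hstep.1 h₁
    exact ⟨true, c₀, h₀, h₂.tail hstep⟩

end Embedding

/-- A nonempty set that is totally ordered by reachability has a last element. -/
theorem MultiDigraph.exists_last {V : Type u} {E : Type v} [Finite V] {G : MultiDigraph V E}
    {A : Set V} (hA : A.Nonempty) (h : ∀ x ∈ A, ∀ y ∈ A, G.Reach x y ∨ G.Reach y x) :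
    ∃ m ∈ A, ∀ x ∈ A, G.Reach x m := by
  obtain ⟨m, hm, hmax⟩ := Set.exists_max_image A (fun m => {y | G.Reach y m}.ncard)
    (Set.toFinite _) hA
  refine ⟨m, hm, fun x hx => ?_⟩
  rcases h x hx m hm with h | h
  · exact h
  · have hsub : {y | G.Reach y m} ⊆ {y | G.Reach y x} := fun y hy =>
      Relation.ReflTransGen.trans hy h
    have := Set.eq_of_subset_of_ncard_le hsub (hmax x hx)
    have hx' : x ∈ {y | G.Reach y x} := Relation.ReflTransGen.refl
    rwa [← this] at hx'

/-- On the boundary of a face of a backward closed subgraph with at most two source corners there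
are at most five vertices that dominate all vertices of the subgraph that reach `v`. -/
theorem Embedding.exists_frame_gates {V : Type u} {E : Type v} [Finite V] [Finite E]
    {G : MultiDigraph V E} {M : Embedding G} (hG : G.Acyclic) {s : V} (hs : ∀ x, G.Reach s x)
    {H : G.Subgraph} (hH : H.BackwardClosed) (hne : H.verts.Nonempty) {f₀ f : M.Face}
    (hK : (M.sourceCorners H (M.dualComponent H f₀)).ncard ≤ 2)
    (hf : f ∈ M.dualComponent H f₀) {v : V} (hv : v ∉ H.verts) (hvf : v ∈ (M.bc f).verts) :
    ∃ W : Set V, W.Nonempty ∧ W.ncard ≤ 5 ∧ (∀ w ∈ W, w ∈ H.verts ∧ G.Reach w v) ∧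
      ∀ u ∈ H.verts, G.Reach u v → ∃ w ∈ W, G.Reach u w := by
  classical
  have hback : ∀ {x y}, G.Reach x y → y ∈ H.verts → x ∈ H.verts := by
    intro x y h hy
    induction h using Relation.ReflTransGen.head_induction_on with
    | refl => exact hy
    | head h _ ih =>
      obtain ⟨e, rfl, rfl⟩ := h
      exact H.src_mem e (hH e ih)
  have hsH : s ∈ H.verts := hback (hs _) hne.choose_spec
  set run : (Dart E × Dart E) × Bool → Set V := fun q =>
    {x | ∃ c, Relation.ReflTransGen (M.CornerStep H f₀ q.2) q.1 c ∧ G.base c.1 = x ∧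
      x ∈ H.verts ∧ G.Reach x v} with hrun
  have hlast : ∀ q, ∃ m, m ∈ H.verts ∧ G.Reach m v ∧ ∀ x ∈ run q, G.Reach x m := by
    intro q
    rcases (run q).eq_empty_or_nonempty with h | h
    -- A run without vertices that reach `v` gets the harmless default `s`.
    · exact ⟨s, hsH, hs v, by simp [h]⟩
    · obtain ⟨m, ⟨c, -, -, h₁, h₂⟩, h₃⟩ := exists_last h (by
        rintro x ⟨c, hc, rfl, -⟩ y ⟨c', hc', rfl, -⟩
        have hu : Relator.RightUnique (M.CornerStep H f₀ q.2) := fun _ _ _ h₁ h₂ => h₁.unique h₂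
        exact (Relation.ReflTransGen.total_of_right_unique hu hc hc').imp
          reach_of_cornerSteps reach_of_cornerSteps)
      exact ⟨m, h₁, h₂, h₃⟩
  choose m hmH hmv hm using hlast
  set Src := M.sourceCorners H (M.dualComponent H f₀)
  -- Two source corners with two directions each, and the source: five gates.
  refine ⟨insert s (m '' (Src ×ˢ Set.univ)), ⟨s, by simp⟩, ?_, ?_, fun u hu huv => ?_⟩
  · have h₁ : (Src ×ˢ (Set.univ : Set Bool)).ncard ≤ 4 := by
      rw [Set.ncard_prod, Set.ncard_univ]
      simp
      omega
    have h₂ := Set.ncard_image_le (f := m) (Set.toFinite (Src ×ˢ (Set.univ : Set Bool)))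
    have h₃ := Set.ncard_insert_le s (m '' (Src ×ˢ Set.univ))
    omega
  · rintro w (rfl | ⟨q, -, rfl⟩)
    exacts [⟨hsH, hs v⟩, ⟨hmH q, hmv q⟩]
  obtain ⟨l, hl, -⟩ := huv.reachVia (p := fun _ => True) (fun _ _ => trivial)
  obtain ⟨l₁, e, l₂, rfl, he, hexit⟩ := hl.exists_last_exit hu hv
  obtain ⟨_, hl₁, rfl, hl₂⟩ := isWalk_append.1 hl
  have hte : G.tgt e ∉ H.verts := hexit e (by simp)
  have heH : e ∉ H.edges := fun h => hte (H.tgt_mem e h)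
  have hev : G.Reach (G.src e) v := (reach_edge e).trans hl₂.reach
  -- From the head of `e` on, the path avoids `H`, so the face at `e` is in the same dual component
  -- as `f`.
  have hface : M.faceOf (e, true) ∈ M.dualComponent H f₀ := by
    have h₁ : G.tgt e ∈ (M.bc f).verts := by
      obtain ⟨a, ha, h⟩ := hvf
      exact ⟨a, ha, hl₂.reach.trans h⟩
    have h₂ := dualReach_of_mem_bc hH hte h₁ (g := M.faceOf (e, true))
      (Or.inl ⟨M.rot.symm (e, false), M.base_symm _, by
        rw [M.faceOf_symm, rev_mk, Bool.not_false]⟩)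
    exact (mem_dualComponent_congr h₂).2 hf
  by_cases hd : ∃ d₀ : Dart E, d₀.1 ∈ H.edges ∧ G.base d₀ = G.src e
  · obtain ⟨d₀, hd₀, hb⟩ := hd
    obtain ⟨d, k, hdH, hk, hg, hmin⟩ := exists_prev_dart (M := M) (g := (e, true)) hd₀ hb
    obtain ⟨d', hcor⟩ := exists_next_corner (M := M) hdH
    have hbase : G.base d = G.src e := by rw [← M.base_pow k d, hg]; rfl
    have h₁ := dualReach_pow (M := M) (H := H) (d := d) (k := k) (by
      intro j h₁ h₂
      rcases h₂.eq_or_lt with rfl | h₂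
      · rwa [hg]
      · exact hmin j h₁ h₂)
    rw [hg] at h₁
    obtain ⟨fwd, c₀, hc₀, hsteps⟩ := exists_source_corner hG (c := (d, d'))
      ⟨hcor, (mem_dualComponent_congr h₁).2 hface⟩
    exact ⟨m (c₀, fwd), Or.inr ⟨(c₀, fwd), ⟨hc₀, trivial⟩, rfl⟩,
      hl₁.reach.trans (hm (c₀, fwd) _ ⟨(d, d'), hsteps, hbase, he, hev⟩)⟩
  -- A vertex of `H` without edges in `H` has no ingoing edge, as `H` is backward closed, and hence
  -- is `s`.
  · refine ⟨s, Or.inl rfl, ?_⟩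
    rcases Relation.ReflTransGen.cases_tail (hs (G.src e)) with h | ⟨y, -, g, -, hg⟩
    · exact h ▸ hl₁.reach
    · exact absurd ⟨(g, false), hH g (hg ▸ he), hg⟩ hd

/-! ### Least nodes and gates in the decomposition tree -/

namespace STDecomposition

variable {V : Type u} {E : Type v} {G : MultiDigraph V E} {M : Embedding G} {T : RootedTree.{t}}

theorem finite_tree [Finite V] [Finite E] (D : STDecomposition M T) : Finite T :=
  Finite.of_injective D.face D.face_bijective.injective

variable (D : STDecomposition M T)

theorem S_eq [Finite V] [Finite E] (x : T) :
    (∀ v, v ∈ (D.S x).verts ↔ ∃ z ≤ x, v ∈ (M.bc (D.face z)).verts) ∧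
      ∀ e, e ∈ (D.S x).edges ↔ G.tgt e ∈ (D.S x).verts := by
  have := D.finite_tree
  induction x using WellFoundedLT.induction with
  | _ x ih =>
  by_cases hx : IsMin x
  · obtain rfl : x = ⊥ := isMin_iff_eq_bot.1 hx
    rw [D.S_root]
    refine ⟨fun v => ⟨fun h => ⟨⊥, le_rfl, h⟩, ?_⟩, fun e => Iff.rfl⟩
    rintro ⟨z, hz, h⟩
    rwa [le_bot_iff.1 hz] at h
  · have hcov := Order.pred_covBy_of_not_isMin hx
    obtain ⟨ih₁, ih₂⟩ := ih _ hcov.lt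
    rw [D.S_child _ _ hcov]
    constructor
    · intro v
      change v ∈ (M.bc (D.face x)).verts ∨ v ∈ (D.S (Order.pred x)).verts ↔ _
      rw [ih₁]
      constructor
      · rintro (h | ⟨z, hz, h⟩)
        exacts [⟨x, le_rfl, h⟩, ⟨z, hz.trans hcov.le, h⟩]
      · rintro ⟨z, hz, h⟩
        rcases hz.eq_or_lt with rfl | hz
        exacts [Or.inl h, Or.inr ⟨z, Order.le_pred_of_lt hz, h⟩]
    · intro e
      change e ∈ (M.bc (D.face x)).edges ∨ e ∈ (D.S (Order.pred x)).edges ↔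
        G.tgt e ∈ (M.bc (D.face x)).verts ∨ G.tgt e ∈ (D.S (Order.pred x)).verts
      rw [ih₂]
      rfl

theorem S_backwardClosed [Finite V] [Finite E] (x : T) : (D.S x).BackwardClosed :=
  fun e he => ((D.S_eq x).2 e).2 he

theorem mem_S_of_reach [Finite V] [Finite E] {x : T} {u v : V} (h : G.Reach u v)
    (hv : v ∈ (D.S x).verts) : u ∈ (D.S x).verts := by
  rw [(D.S_eq x).1] at hv ⊢
  obtain ⟨z, hz, a, ha, hva⟩ := hv
  exact ⟨z, hz, a, ha, h.trans hva⟩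

theorem exists_child {y x : T} (h : y < x) : ∃ z, y ⋖ z ∧ z ≤ x := by
  obtain ⟨n, hn⟩ := h.le.exists_pred_iterate
  induction n generalizing x with
  | zero => exact absurd hn h.ne'
  | succ n ih =>
    rw [Function.iterate_succ_apply] at hn
    have hx : ¬ IsMin x := fun hx => not_lt_of_ge (hx h.le) h
    have hcov := Order.pred_covBy_of_not_isMin hx
    rcases (Order.le_pred_of_lt h).eq_or_lt with h' | h'
    · rw [← h'] at hcov
      exact ⟨x, hcov, le_rfl⟩
    · obtain ⟨z, h₁, h₂⟩ := ih h' hn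
      exact ⟨z, h₁, h₂.trans hcov.le⟩

/-- The nodes whose backward closures contain `v` have a least element. -/
theorem exists_least_node [Finite V] [Finite E] (v : V) :
    ∃ c : T, v ∈ (M.bc (D.face c)).verts ∧ ∀ x, v ∈ (D.S x).verts ↔ c ≤ x := by
  have := D.finite_tree
  set N : Set T := {x | v ∈ (M.bc (D.face x)).verts} with hN
  -- Otherwise the faces around `v` connect the faces of `x` and `x'` in the dual graph without `S
  -- (x ⊓ x')`. Then both nodes are below the same child of `x ⊓ x'`, which is absurd.
  have hdir : ∀ x ∈ N, ∀ x' ∈ N, v ∈ (D.S (x ⊓ x')).verts := by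
    intro x hx x' hx'
    by_contra hv
    have hlt : x ⊓ x' < x := by
      refine inf_le_left.lt_of_ne fun h => hv (((D.S_eq _).1 v).2 ⟨x, h.ge, hx⟩)
    obtain ⟨z, hz, hzx⟩ := exists_child hlt
    obtain ⟨g, hg⟩ := M.exists_face_mem v
    have h₁ := Embedding.dualReach_of_mem_bc (D.S_backwardClosed (x ⊓ x')) hv hx hg
    have h₂ := Embedding.dualReach_of_mem_bc (D.S_backwardClosed (x ⊓ x')) hv hx' hg
    have h₃ : D.face x ∈ M.dualComponent (D.S (x ⊓ x')) (D.face z) := by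
      rw [← D.dual_child _ _ hz]
      exact ⟨x, hzx, rfl⟩
    have h₄ := (Embedding.mem_dualComponent_congr h₂).1
      ((Embedding.mem_dualComponent_congr h₁).2 h₃)
    rw [← D.dual_child _ _ hz] at h₄
    obtain ⟨x'', hx'', h₅⟩ := h₄
    obtain rfl := D.face_bijective.injective h₅
    exact not_le_of_gt hz.lt (le_inf hzx hx'')
  have hNne : N.Nonempty := by
    obtain ⟨g, hg⟩ := M.exists_face_mem v
    obtain ⟨x, rfl⟩ := D.face_bijective.surjective g
    exact ⟨x, v, hg, .refl⟩
  obtain ⟨c, hc⟩ := (Set.toFinite N).exists_minimal hNne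
  refine ⟨c, hc.1, fun x => ⟨fun hx => ?_, fun hx => ((D.S_eq x).1 v).2 ⟨c, hx, hc.1⟩⟩⟩
  obtain ⟨x', hx'x, hx'⟩ := ((D.S_eq x).1 v).1 hx
  obtain ⟨z, hz, hzv⟩ := ((D.S_eq _).1 v).1 (hdir c hc.1 x' hx')
  exact ((hc.2 hzv (hz.trans inf_le_left)).trans (hz.trans inf_le_right)).trans hx'x

/-- For a node `y` whose subgraph `S_y` does not contain `v`, or just contains it, at most five
vertices of `S_y` that reach `v` dominate all others. -/
theorem exists_gates [Finite V] [Finite E] (hG : G.Acyclic) (hs : G.SingleSource)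
    (hD : D.AllFramesTwoOrFour) {y c : T} {v : V} (hc : v ∈ (M.bc (D.face c)).verts)
    (hc' : ∀ x, v ∈ (D.S x).verts ↔ c ≤ x) (hy : y ≤ c) :
    ∃ W : Set V, W.Nonempty ∧ W.ncard ≤ 5 ∧ (∀ w ∈ W, w ∈ (D.S y).verts ∧ G.Reach w v) ∧
      ∀ u ∈ (D.S y).verts, G.Reach u v → ∃ w ∈ W, G.Reach u w := by
  rcases hy.eq_or_lt with rfl | hy
  · exact ⟨{v}, by simp, by simp, by simpa using ⟨(hc' y).2 le_rfl, .refl⟩,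
      fun u _ huv => ⟨v, rfl, huv⟩⟩
  obtain ⟨x, hyx, hxc⟩ := exists_child hy
  obtain ⟨s, hs⟩ := hs
  have hcomp := D.dual_child _ _ hyx
  have hK : (M.sourceCorners (D.S y) (M.dualComponent (D.S y) (D.face x))).ncard ≤ 2 := by
    rw [← hcomp]
    rcases hD y x hyx with ⟨a, h₁, h₂, -⟩ | ⟨a, h₁, h₂, -⟩ <;> omega
  refine Embedding.exists_frame_gates hG hs (D.S_backwardClosed y) ?_ hK (f := D.face c) ?_ ?_ hc
  · obtain ⟨a, ha⟩ := M.exists_mem_faceVerts (D.face y)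
    exact ⟨a, ((D.S_eq y).1 a).2 ⟨y, le_rfl, a, ha, .refl⟩⟩
  · rw [← hcomp]
    exact ⟨c, hxc, rfl⟩
  · exact fun h => not_le_of_gt hy ((hc' y).1 h)

end STDecomposition

end PlanarReach

namespace PlanarReach

/-! ### The numbers stored in a label -/

open MultiDigraph

/-- A nonempty set with at most `k` elements is the range of a sequence already on its first `k`
members. -/
theorem exists_enumeration {α : Type*} {W : Set α} {k : ℕ} (hfin : W.Finite) (hne : W.Nonempty)
    (hk : W.ncard ≤ k) : ∃ g : ℕ → α, (∀ j, g j ∈ W) ∧ ∀ w ∈ W, ∃ j < k, g j = w := by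
  classical
  obtain ⟨w₀, hw₀⟩ := hne
  have := hfin.to_subtype
  have hcard : Nat.card W = W.ncard := rfl
  let e := Finite.equivFin W
  refine ⟨fun j => if h : j < Nat.card W then e.symm ⟨j, h⟩ else w₀, fun j => ?_, fun w hw => ?_⟩
  · dsimp only
    split_ifs
    exacts [(e.symm _).2, hw₀]
  · refine ⟨e ⟨w, hw⟩, by have := (e ⟨w, hw⟩).2; omega, ?_⟩
    simp only [Fin.is_lt, dif_pos, Fin.eta, Equiv.symm_apply_apply]

theorem ncard_Iio_le_height {T : RootedTree.{t}} [Finite T] (x : T) :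
    ((Set.Iio x).ncard : ℕ∞) ≤ Order.height x := by
  induction x using WellFoundedLT.induction with
  | _ x ih =>
  by_cases hx : IsMin x
  · have : Set.Iio x = ∅ := Set.eq_empty_of_forall_notMem fun y hy => hx.not_lt hy
    simp [this]
  · have hcov := Order.pred_covBy_of_not_isMin hx
    have hsub : Set.Iio x ⊆ insert (Order.pred x) (Set.Iio (Order.pred x)) := fun y hy =>
      (Order.le_pred_of_lt hy).eq_or_lt
    have h₁ := (Set.ncard_le_ncard hsub).trans (Set.ncard_insert_le _ _)
    calc ((Set.Iio x).ncard : ℕ∞) ≤ ((Set.Iio (Order.pred x)).ncard + 1 : ℕ) := by exact_mod_cast h₁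
      _ ≤ Order.height (Order.pred x) + 1 := by
        push_cast
        exact add_le_add_left (ih _ hcov.lt) 1
      _ ≤ Order.height x := Order.height_add_one_le hcov.lt

/-- The numbers from which reachability is decided. A vertex `x` stores its depth `dep x`, the
number `idn x` of its node and `a · x`, and, for every `i ≤ dep x`, the number `idv x i` of its
ancestor node of depth `i` and the numbers `b x i j ·` of the `j`-th gate for this node. -/
structure LabelData {V : Type u} {E : Type v} (G : MultiDigraph V E) (h : ℕ) where
  dep : V → ℕ
  idn : V → ℕ
  a : ℕ → V → ℕ
  idv : V → ℕ → ℕ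
  b : V → ℕ → ℕ → ℕ → ℕ
  dep_le : ∀ x, dep x ≤ h
  dep_le_card : ∀ x, dep x ≤ Nat.card V
  idn_pos : ∀ x, 0 < idn x
  idn_le : ∀ x, idn x ≤ Nat.card V
  a_le : ∀ k x, a k x ≤ Nat.card V + 1
  idv_le : ∀ x i, idv x i ≤ Nat.card V
  idv_eq_zero : ∀ x i, dep x < i → idv x i = 0
  b_le : ∀ x i j k, b x i j k ≤ Nat.card V + 1
  reach_iff : ∀ x y, G.Reach x y ↔ idv y (dep x) = idn x ∧ ∃ j < 5,
    a 0 x ≤ b y (dep x) j 0 ∨ a 1 x ≤ b y (dep x) j 1 ∧ a 2 x ≤ b y (dep x) j 2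

theorem AdmitsSTDecomposition.nonempty_labelData {V : Type u} {E : Type v} [Finite V] [Finite E]
    {G : MultiDigraph V E} {h : ℕ} (hadm : AdmitsSTDecomposition.{u, v, t} G h) :
    Nonempty (LabelData G h) := by
  classical
  obtain ⟨hG, hs, M, hM, T, D, hT, hD⟩ := hadm
  have := D.finite_tree
  choose c hc hc' using D.exists_least_node
  have hmono : ∀ {x y}, G.Reach x y → c x ≤ c y := fun {x y} hxy =>
    (hc' x _).1 (D.mem_S_of_reach hxy ((hc' y _).2 le_rfl))
  -- A multigraph can have far more faces than vertices. Counting only nodes of the form `c x`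
  -- bounds the depth by `|V|` as well as by `h`, so that it fits into a word.
  set dep : V → ℕ := fun x => {t ∈ Set.range c | t < c x}.ncard with hdep
  have dep_lt : ∀ {x y}, c x < c y → dep x < dep y := fun {x y} hxy =>
    Set.ncard_lt_ncard ⟨fun t ht => ⟨ht.1, ht.2.trans hxy⟩, fun hsub =>
      lt_irrefl (c x) (hsub ⟨⟨x, rfl⟩, hxy⟩).2⟩
  have dep_eq : ∀ {x x' y}, c x ≤ c y → c x' ≤ c y → dep x = dep x' → c x = c x' := by
    intro x x' y h₁ h₂ h₃
    rcases le_total_of_directed h₁ h₂ with h | h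
    · exact (h.eq_or_lt.resolve_right fun h => (dep_lt h).ne' h₃).symm
    · exact h.eq_or_lt.resolve_right fun h => (dep_lt h).ne h₃
  have hex : ∀ q : Set.range c, ∃ z, c z = q := fun q => q.2
  choose rep hrep using hex
  -- For the same reason a node is numbered by a representative vertex. The shift by 1 leaves 0 to
  -- mark a missing entry.
  set idn : V → ℕ := fun x => (Finite.equivFin V (rep ⟨c x, x, rfl⟩) : ℕ) + 1 with hidn
  have idn_inj : ∀ {x x'}, idn x = idn x' → c x = c x' := by
    intro x x' hx
    have := (Finite.equivFin V).injective (Fin.ext (Nat.succ_injective hx))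
    exact (hrep ⟨c x, x, rfl⟩).symm.trans ((congrArg c this).trans (hrep _))
  have idn_congr : ∀ {x x'}, c x = c x' → idn x = idn x' := by
    intro x x' hx
    simp only [hidn, hx]
  have idn_le : ∀ x, idn x ≤ Nat.card V := fun x => (Finite.equivFin V _).2
  choose fa fb hfab hface using fun q : T => M.exists_face_order hG hs hM (D.face q)
  have hgates : ∀ x y, ∃ g : ℕ → V, c x ≤ c y →
      (∀ j, c (g j) ≤ c x ∧ G.Reach (g j) y) ∧
        ∀ z, c z ≤ c x → G.Reach z y → ∃ j < 5, G.Reach z (g j) := by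
    intro x y
    by_cases hxy : c x ≤ c y
    · obtain ⟨W, h₁, h₂, h₃, h₄⟩ := D.exists_gates hG hs hD (hc y) (hc' y) hxy
      obtain ⟨g, h₅, h₆⟩ := exists_enumeration (Set.toFinite W) h₁ h₂
      refine ⟨g, fun _ => ⟨fun j => ⟨(hc' _ _).1 (h₃ _ (h₅ j)).1, (h₃ _ (h₅ j)).2⟩,
        fun z hz hzy => ?_⟩⟩
      obtain ⟨w, hw, hzw⟩ := h₄ z ((hc' _ _).2 hz) hzy
      obtain ⟨j, hj, rfl⟩ := h₆ w hw
      exact ⟨j, hj, hzw⟩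
    · exact ⟨fun _ => x, fun h => absurd h hxy⟩
  choose gate hgate using hgates
  set anc : V → ℕ → Prop := fun y i => ∃ x, c x ≤ c y ∧ dep x = i with hanc
  have hrange : ∀ S : Set T, {t ∈ Set.range c | t ∈ S}.ncard ≤ Nat.card V := by
    intro S
    refine (Set.ncard_le_ncard (fun t ht => ht.1)).trans ?_
    rw [← Set.image_univ]
    exact (Set.ncard_image_le (Set.toFinite _)).trans (Set.ncard_univ V).le
  refine ⟨{
    dep := dep
    idn := idn
    a := fun k x => fa (c x) (Fin.ofNat 3 k) x
    idv := fun y i => if hi : anc y i then idn hi.choose else 0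
    -- A gate that belongs to another node cannot be reached from the vertices of this node. It gets
    -- 0, which fails every comparison because the numbers `a` are at least 1.
    b := fun y i j k => if hi : anc y i then
      if c (gate hi.choose y j) = c hi.choose then
        fb (c hi.choose) (Fin.ofNat 3 k) (gate hi.choose y j) else 0 else 0
    dep_le := ?_
    dep_le_card := fun x => hrange (Set.Iio (c x))
    idn_pos := fun x => Nat.succ_pos _
    idn_le := idn_le
    a_le := fun k x => (hfab _ _ _).2.1
    idv_le := ?_
    idv_eq_zero := ?_
    b_le := ?_
    reach_iff := ?_ }⟩
  · intro x
    have h₁ : dep x ≤ (Set.Iio (c x)).ncard := Set.ncard_le_ncard fun t ht => ht.2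
    have h₂ := ncard_Iio_le_height (c x)
    have h₃ : Order.height (c x) ≤ treeHeight T := le_iSup (fun x : T => Order.height x) (c x)
    rw [hT] at h₃
    exact h₁.trans (by exact_mod_cast h₂.trans h₃)
  · intro x i
    split_ifs
    exacts [idn_le _, Nat.zero_le _]
  · intro x i hi
    rw [dif_neg]
    rintro ⟨z, hz, rfl⟩
    rcases hz.eq_or_lt with h | h
    · simp [hdep, h] at hi
    · exact lt_asymm hi (dep_lt h)
  · intro x i j k
    split_ifs
    exacts [(hfab _ _ _).2.2.trans (Nat.le_succ _), Nat.zero_le _, Nat.zero_le _]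
  · intro x y
    constructor
    · intro hxy
      have hi : anc y (dep x) := ⟨x, hmono hxy, rfl⟩
      have hx : c hi.choose = c x := dep_eq hi.choose_spec.1 (hmono hxy) hi.choose_spec.2
      simp only [dif_pos hi]
      obtain ⟨h₁, h₂⟩ := hgate _ _ hi.choose_spec.1
      obtain ⟨j, hj, hxj⟩ := h₂ x hx.ge hxy
      -- The gate is in the subgraph of the node of `x` and is reached from `x`, so both nodes
      -- coincide and the face order applies.
      have hcj : c (gate hi.choose y j) = c hi.choose :=
        le_antisymm (h₁ j).1 (hx.le.trans (hmono hxj))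
      refine ⟨idn_congr hx, j, hj, ?_⟩
      rw [hx] at hcj
      simp only [hx, if_pos hcj]
      refine (hface (c x) x (hc x) _ ?_).1 hxj
      have := hc (gate hi.choose y j)
      rwa [hcj] at this
    · rintro ⟨h₁, j, -, h₂⟩
      have hi : anc y (dep x) := by
        by_contra hi
        rw [dif_neg hi] at h₁
        exact absurd h₁ (Nat.succ_ne_zero _).symm
      simp only [dif_pos hi] at h₁ h₂
      have hx : c hi.choose = c x := idn_inj h₁
      by_cases hcj : c (gate hi.choose y j) = c hi.choose
      · rw [hx] at hcj
        simp only [hx, if_pos hcj] at h₂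
        have hw := hc (gate hi.choose y j)
        rw [hcj] at hw
        exact ((hface (c x) x (hc x) _ hw).2 h₂).trans
          (((hgate _ _ hi.choose_spec.1).1 j).2)
      · exfalso
        simp only [if_neg hcj] at h₂
        have h₃ := (hfab (c x) (Fin.ofNat 3 0) x).1
        have h₄ := (hfab (c x) (Fin.ofNat 3 1) x).1
        omega

end PlanarReach

/-! ### Labels as arrays of words, and the decision program -/

namespace PlanarReach

/-- The bit string that consists of the words `f 0, …, f (m - 1)` of `w` bits. -/
def packWords (w m : ℕ) (f : ℕ → ℕ) : List Bool :=
  List.ofFn fun i : Fin (m * w) => (f (i / w)).testBit (i % w)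

theorem wordAt_packWords {w m : ℕ} {f : ℕ → ℕ} (hf : ∀ i < m, f i < 2 ^ w) (i : ℕ) :
    wordAt w (packWords w m f) i = if i < m then f i else 0 := by
  unfold wordAt
  apply Nat.eq_of_testBit_eq
  intro j
  by_cases hj : j < w
  · rw [Nat.testBit_ofBits_lt _ _ hj]
    by_cases hi : i < m
    · have hlt : i * w + j < m * w := by nlinarith
      have h₁ : (i * w + j) / w = i := by
        rw [mul_comm, Nat.mul_add_div (by omega), Nat.div_eq_of_lt hj, add_zero]
      have h₂ : (i * w + j) % w = j := by
        rw [mul_comm, Nat.mul_add_mod, Nat.mod_eq_of_lt hj]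
      simp [packWords, List.getD_eq_getElem?_getD, hlt, hi, h₁, h₂]
    · have hge : ¬ i * w + j < m * w := by nlinarith
      simp [packWords, List.getD_eq_getElem?_getD, hge, hi]
  · rw [Nat.testBit_ofBits_ge _ _ (by omega)]
    split_ifs with hi
    · exact (Nat.testBit_lt_two_pow ((hf i hi).trans_le
        (Nat.pow_le_pow_right (by norm_num) (by omega)))).symm
    · simp

/-- The decision program. Register 2 walks through the gates of the second label for the node of
the first label, register 8 counts them. -/
def reachProgram : Program :=
  [.const 1 1, .inputFst 2 0, .inputFst 3 1, .const 7 2, .inputFst 4 7, .const 7 3,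
    .inputFst 5 7, .const 7 4, .inputFst 6 7, .const 9 5, .inputSnd 7 2, .jumpEq 7 3 13,
    .halt false, .jumpLt 8 9 15, .halt false, .add 8 8 1, .add 2 2 1, .inputSnd 7 2, .add 2 2 1,
    .jumpLt 7 4 21, .halt true, .inputSnd 7 2, .add 2 2 1, .jumpLt 7 5 13, .inputSnd 7 2,
    .jumpLt 7 6 13, .halt true]

/-- The configurations before the gate with number `j` is examined. -/
structure AtGate (A a₀ a₁ a₂ j : ℕ) (s : Config) : Prop where
  pc : s.pc = 13
  one : s.reg 1 = 1
  addr : s.reg 2 = A + 3 * j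
  fst : s.reg 4 = a₀
  snd : s.reg 5 = a₁
  trd : s.reg 6 = a₂
  count : s.reg 8 = j
  bound : s.reg 9 = 5

/-- Induction on the number `i` of gates left. A pass takes at most 12 instructions and, if the gate
fails, advances register 2 by 3, even if the third number is not read. The register points to the
word before the gate. -/
theorem run_atGate {w : ℕ} {x y : List Bool} {A a₀ a₁ a₂ : ℕ} {b : ℕ → ℕ → ℕ}
    (hA : A + 16 < 2 ^ w) (hb : ∀ j k, b j k < 2 ^ w)
    (hy : ∀ j < 5, ∀ k < 3, wordAt w y (A + 3 * j + k + 1) = b j k) (i j : ℕ) (hij : i + j = 5)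
    (s : Config) (hs : AtGate A a₀ a₁ a₂ j s) (fuel : ℕ) (hfuel : 12 * (i + 1) ≤ fuel) :
    ∃ answer, reachProgram.run w x y fuel s = some answer ∧ (answer = true ↔
      ∃ j', j ≤ j' ∧ j' < 5 ∧ (a₀ ≤ b j' 0 ∨ a₁ ≤ b j' 1 ∧ a₂ ≤ b j' 2)) := by
  induction i generalizing j s fuel with
  | zero =>
    obtain rfl : j = 5 := by omega
    obtain ⟨fuel, rfl⟩ := Nat.exists_eq_add_of_le' hfuel
    refine ⟨false, ?_, ?_⟩
    · simp [Program.run, reachProgram, Instr.exec, Config.branch, hs.pc, hs.count, hs.bound]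
    · simp
      omega
  | succ i ih =>
    have hsplit : (∃ j', j ≤ j' ∧ j' < 5 ∧ (a₀ ≤ b j' 0 ∨ a₁ ≤ b j' 1 ∧ a₂ ≤ b j' 2)) ↔
        (a₀ ≤ b j 0 ∨ a₁ ≤ b j 1 ∧ a₂ ≤ b j 2) ∨
          ∃ j', j + 1 ≤ j' ∧ j' < 5 ∧ (a₀ ≤ b j' 0 ∨ a₁ ≤ b j' 1 ∧ a₂ ≤ b j' 2) := by
      constructor
      · rintro ⟨j', h₁, h₂, h₃⟩
        obtain rfl | h₁ := h₁.eq_or_lt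
        exacts [.inl h₃, .inr ⟨j', h₁, h₂, h₃⟩]
      · rintro (h | ⟨j', h₁, h₂, h₃⟩)
        exacts [⟨j, le_rfl, by omega, h⟩, ⟨j', by omega, h₂, h₃⟩]
    rw [hsplit]
    have hj : j < 5 := by omega
    have e₁ : (A + 3 * j + 1) % 2 ^ w = A + 3 * j + 1 := Nat.mod_eq_of_lt (by omega)
    have e₂ : (A + 3 * j + 1 + 1) % 2 ^ w = A + 3 * j + 1 + 1 := Nat.mod_eq_of_lt (by omega)
    have e₃ : (A + 3 * j + 1 + 1 + 1) % 2 ^ w = A + 3 * j + 1 + 1 + 1 :=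
      Nat.mod_eq_of_lt (by omega)
    have e₄ : (j + 1) % 2 ^ w = j + 1 := Nat.mod_eq_of_lt (by omega)
    have e₅ : ∀ k, b j k % 2 ^ w = b j k := fun k => Nat.mod_eq_of_lt (hb j k)
    have y₀ : wordAt w y (A + 3 * j + 1) = b j 0 := hy j hj 0 (by omega)
    have y₁ : wordAt w y (A + 3 * j + 1 + 1) = b j 1 := hy j hj 1 (by omega)
    have y₂ : wordAt w y (A + 3 * j + 1 + 1 + 1) = b j 2 := hy j hj 2 (by omega)
    by_cases h₀ : b j 0 < a₀
    · by_cases h₁ : b j 1 < a₁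
      · obtain ⟨fuel, rfl⟩ := Nat.exists_eq_add_of_le' (show 9 ≤ fuel by omega)
        rw [or_iff_right_of_imp fun h => absurd h (by omega)]
        simp only [Program.run, reachProgram, Instr.exec, Config.branch, Config.setReg, hs.pc,
          hs.one, hs.addr, hs.fst, hs.snd, hs.count, hs.bound, e₁, e₂, e₃, e₄, e₅, y₀, y₁,
          h₀, h₁, hj, List.getElem?_cons_succ, List.getElem?_cons_zero, Function.update_self,
          Function.update_of_ne, decide_true, if_true, ne_eq, Nat.reduceEqDiff, not_false_eq_true,
          Nat.reduceAdd, OfNat.one_ne_ofNat]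
        refine ih (j + 1) (by omega) _ ?_ fuel (by omega)
        constructor <;> simp [hs.one, hs.fst, hs.snd, hs.trd, hs.bound, mul_add, add_assoc]
      by_cases h₂ : b j 2 < a₂
      · obtain ⟨fuel, rfl⟩ := Nat.exists_eq_add_of_le' (show 11 ≤ fuel by omega)
        rw [or_iff_right_of_imp fun h => absurd h (by omega)]
        simp only [Program.run, reachProgram, Instr.exec, Config.branch, Config.setReg, hs.pc,
          hs.one, hs.addr, hs.fst, hs.snd, hs.trd, hs.count, hs.bound, e₁, e₂, e₃, e₄, e₅, y₀, y₁,
          y₂, h₀, h₁, h₂, hj, List.getElem?_cons_succ, List.getElem?_cons_zero,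
          Function.update_self,
          Function.update_of_ne, decide_true, if_true, ne_eq, Nat.reduceEqDiff, not_false_eq_true,
          Nat.reduceAdd, OfNat.one_ne_ofNat, decide_false, Bool.false_eq_true, if_false]
        refine ih (j + 1) (by omega) _ ?_ fuel (by omega)
        constructor <;> simp [hs.one, hs.fst, hs.snd, hs.trd, hs.bound, mul_add, add_assoc]
      · obtain ⟨fuel, rfl⟩ := Nat.exists_eq_add_of_le' (show 12 ≤ fuel by omega)
        refine ⟨true, ?_, by simp; omega⟩
        simp only [Program.run, reachProgram, Instr.exec, Config.branch, Config.setReg, hs.pc,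
          hs.one, hs.addr, hs.fst, hs.snd, hs.trd, hs.count, hs.bound, e₁, e₂, e₃, e₄, e₅, y₀, y₁,
          y₂, h₀, h₁, h₂, hj, List.getElem?_cons_succ, List.getElem?_cons_zero,
          Function.update_self,
          Function.update_of_ne, decide_true, if_true, ne_eq, Nat.reduceEqDiff, not_false_eq_true,
          Nat.reduceAdd, OfNat.one_ne_ofNat, decide_false, Bool.false_eq_true, if_false]
    · obtain ⟨fuel, rfl⟩ := Nat.exists_eq_add_of_le' (show 12 ≤ fuel by omega)
      refine ⟨true, ?_, by simp; omega⟩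
      simp only [Program.run, reachProgram, Instr.exec, Config.branch, Config.setReg, hs.pc,
        hs.one, hs.addr, hs.fst, hs.count, hs.bound, e₁, e₂, e₄, e₅, y₀,
        h₀, hj, List.getElem?_cons_succ, List.getElem?_cons_zero, Function.update_self,
        Function.update_of_ne, decide_true, if_true, ne_eq, Nat.reduceEqDiff, not_false_eq_true,
        Nat.reduceAdd, OfNat.one_ne_ofNat, decide_false, Bool.false_eq_true, if_false]

/-- The output of `reachProgram`: the first label gives the position `A` of the entry for its node
`t` in the second label, and the ranks that are compared with those of the five gates there. -/
theorem run_reachProgram {w : ℕ} {x y : List Bool} {A t a₀ a₁ a₂ : ℕ} {b : ℕ → ℕ → ℕ}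
    (hA : A + 16 < 2 ^ w) (ht : t < 2 ^ w) (h₀ : a₀ < 2 ^ w) (h₁ : a₁ < 2 ^ w) (h₂ : a₂ < 2 ^ w)
    (hb : ∀ j k, b j k < 2 ^ w) (x₀ : wordAt w x 0 = A) (x₁ : wordAt w x 1 = t)
    (x₂ : wordAt w x 2 = a₀) (x₃ : wordAt w x 3 = a₁) (x₄ : wordAt w x 4 = a₂)
    (yw : wordAt w y A < 2 ^ w)
    (hy : wordAt w y A = t → ∀ j < 5, ∀ k < 3, wordAt w y (A + 3 * j + k + 1) = b j k)
    (fuel : ℕ) (hfuel : 84 ≤ fuel) :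
    ∃ answer, reachProgram.run w x y fuel Config.initial = some answer ∧ (answer = true ↔
      wordAt w y A = t ∧ ∃ j < 5, (a₀ ≤ b j 0 ∨ a₁ ≤ b j 1 ∧ a₂ ≤ b j 2)) := by
  have m₁ : 1 % 2 ^ w = 1 := Nat.mod_eq_of_lt (by omega)
  have m₂ : 2 % 2 ^ w = 2 := Nat.mod_eq_of_lt (by omega)
  have m₃ : 3 % 2 ^ w = 3 := Nat.mod_eq_of_lt (by omega)
  have m₄ : 4 % 2 ^ w = 4 := Nat.mod_eq_of_lt (by omega)
  have m₅ : 5 % 2 ^ w = 5 := Nat.mod_eq_of_lt (by omega)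
  have mA : A % 2 ^ w = A := Nat.mod_eq_of_lt (by omega)
  have mt : t % 2 ^ w = t := Nat.mod_eq_of_lt ht
  have n₀ : a₀ % 2 ^ w = a₀ := Nat.mod_eq_of_lt h₀
  have n₁ : a₁ % 2 ^ w = a₁ := Nat.mod_eq_of_lt h₁
  have n₂ : a₂ % 2 ^ w = a₂ := Nat.mod_eq_of_lt h₂
  have my : wordAt w y A % 2 ^ w = wordAt w y A := Nat.mod_eq_of_lt yw
  by_cases h : wordAt w y A = t
  -- Twelve instructions precede the gates, and 12 are allowed for each of five passes and the final
  -- test, whence 84.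
  · obtain ⟨fuel, rfl⟩ := Nat.exists_eq_add_of_le' (show 12 ≤ fuel by omega)
    simp only [h, true_and]
    have key := run_atGate (x := x) (a₀ := a₀) (a₁ := a₁) (a₂ := a₂) hA hb (hy h) 5 0 rfl
    simp only [zero_le, true_and] at key
    simp only [Program.run, reachProgram, Instr.exec, Config.branch, Config.setReg, Config.initial,
      m₁, m₂, m₃, m₄, m₅, mA, mt, n₀, n₁, n₂, x₀, x₁, x₂, x₃, x₄, h,
      List.getElem?_cons_succ, List.getElem?_cons_zero, Function.update_self,
      Function.update_of_ne, decide_true, if_true, ne_eq, Nat.reduceEqDiff, not_false_eq_true,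
      Nat.reduceAdd, OfNat.one_ne_ofNat, zero_add]
    refine key _ ?_ fuel (by omega)
    constructor <;> simp
  · obtain ⟨fuel, rfl⟩ := Nat.exists_eq_add_of_le' (show 13 ≤ fuel by omega)
    refine ⟨false, ?_, by simp [h]⟩
    simp only [Program.run, reachProgram, Instr.exec, Config.branch, Config.setReg, Config.initial,
      m₁, m₂, m₃, m₄, m₅, mA, mt, n₀, n₁, n₂, x₀, x₁, x₂, x₃, x₄, h, my,
      List.getElem?_cons_succ, List.getElem?_cons_zero, Function.update_self,
      Function.update_of_ne, decide_false, if_false, Bool.false_eq_true, ne_eq, Nat.reduceEqDiff,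
      not_false_eq_true, Nat.reduceAdd, OfNat.one_ne_ofNat, zero_add]

namespace LabelData

variable {V : Type u} {E : Type v} {G : MultiDigraph V E} {h : ℕ}

/-- The words of the label of a vertex. -/
def word (d : LabelData G h) (x : V) : ℕ → ℕ
  | 0 => 5 + 16 * d.dep x
  | 1 => d.idn x
  | 2 => d.a 0 x
  | 3 => d.a 1 x
  | 4 => d.a 2 x
  | i + 5 => if i % 16 = 0 then d.idv x (i / 16) else
      d.b x (i / 16) ((i % 16 - 1) / 3) ((i % 16 - 1) % 3)

/-- The label of a vertex, on words of `w` bits. -/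
def label (d : LabelData G h) (w : ℕ) (x : V) : List Bool :=
  packWords w (5 + 16 * (d.dep x + 1)) (d.word x)

theorem word_le (d : LabelData G h) (x : V) (i : ℕ) : d.word x i ≤ 16 * Nat.card V + 5 := by
  have h₀ := d.dep_le_card x
  have h₁ := d.idn_le x
  have h₂ := d.a_le 0 x
  have h₃ := d.a_le 1 x
  have h₄ := d.a_le 2 x
  match i with
  | 0 | 1 | 2 | 3 | 4 => simp only [word]; omega
  | i + 5 =>
    have h₅ := d.idv_le x (i / 16)
    have h₆ := d.b_le x (i / 16) ((i % 16 - 1) / 3) ((i % 16 - 1) % 3)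
    simp only [word]
    split_ifs <;> omega

/-- There are five words for the vertex and 16 per level, one for the node and three for each of
five gates. Thus `5 + 16 (h + 1) ≤ 21 (h + 1)` words of `7 * logSize V` bits suffice, whence 147. -/
theorem isReachabilityLabelling (d : LabelData G h) {time : ℕ} (ht : 84 ≤ time) :
    IsReachabilityLabelling G reachProgram (7 * logSize V) (d.label (7 * logSize V))
      (147 * (h + 1) * logSize V) time := by
  -- All entries and addresses are at most `16 |V| + 21`, which is below `64 * 2 ^ logSize V`; the
  -- factor 7 suffices since `logSize V` is at least 1.
  have hlarge : 16 * Nat.card V + 21 < 2 ^ (7 * logSize V) := by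
    have h₁ : Nat.card V < 2 ^ logSize V := Nat.lt_pow_succ_log_self one_lt_two _
    have h₂ : 2 ^ (logSize V + 6) ≤ 2 ^ (7 * logSize V) :=
      Nat.pow_le_pow_right two_pos (by unfold logSize; omega)
    rw [pow_add] at h₂
    omega
  generalize hw : 7 * logSize V = w at *
  have hword : ∀ x i, d.word x i < 2 ^ w := fun x i => (d.word_le x i).trans_lt (by omega)
  have hlabel : ∀ x i, wordAt w (d.label w x) i =
      if i < 5 + 16 * (d.dep x + 1) then d.word x i else 0 := fun x i =>
    wordAt_packWords (fun i _ => hword x i) i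
  have hb : ∀ x i j k, d.b x i j k < 2 ^ w := fun x i j k => (d.b_le x i j k).trans_lt (by omega)
  have ha : ∀ k x, d.a k x < 2 ^ w := fun k x => (d.a_le k x).trans_lt (by omega)
  refine ⟨fun x => ?_, fun x y => ?_⟩
  · have hd := d.dep_le x
    rw [label, packWords, List.length_ofFn, ← hw, ← mul_assoc]
    exact Nat.mul_le_mul_right _ (by omega)
  have hA : wordAt w (d.label w y) (5 + 16 * d.dep x) = d.idv y (d.dep x) := by
    rw [hlabel]
    split_ifs with hlt
    · rw [add_comm]
      simp [word]
    · exact (d.idv_eq_zero y _ (by omega)).symm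
  -- Beyond the end of the second label one reads 0, which is no node number. So a match shows that
  -- the whole entry lies inside the label.
  have hdep : d.idv y (d.dep x) = d.idn x → d.dep x ≤ d.dep y := fun he => by
    by_contra! hlt
    have := d.idn_pos x
    rw [d.idv_eq_zero y _ hlt] at he
    omega
  have hx := d.dep_le_card x
  rw [d.reach_iff, ← hA]
  refine run_reachProgram (by omega) ((d.idn_le x).trans_lt (by omega)) (ha 0 x) (ha 1 x) (ha 2 x)
    (hb y (d.dep x)) ?_ ?_ ?_ ?_ ?_ ?_ ?_ time ht
  · simp [hlabel, word]
  · rw [hlabel, if_pos (by omega)]; rfl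
  · rw [hlabel, if_pos (by omega)]; rfl
  · rw [hlabel, if_pos (by omega)]; rfl
  · rw [hlabel, if_pos (by omega)]; rfl
  · exact hA ▸ (d.idv_le y _).trans_lt (by omega)
  · intro he j hj k hk
    have := hdep (hA ▸ he)
    rw [hlabel, if_pos (by omega),
      show 5 + 16 * d.dep x + 3 * j + k + 1 = 16 * d.dep x + 3 * j + k + 1 + 5 by omega]
    have hr : 3 * j + k + 1 < 16 := by omega
    have hq : (16 * d.dep x + 3 * j + k + 1) / 16 = d.dep x := by
      rw [add_assoc, add_assoc, ← add_assoc (3 * j), Nat.mul_add_div (by norm_num),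
        Nat.div_eq_of_lt hr, add_zero]
    have hm : (16 * d.dep x + 3 * j + k + 1) % 16 = 3 * j + k + 1 := by
      rw [add_assoc, add_assoc, ← add_assoc (3 * j), Nat.mul_add_mod, Nat.mod_eq_of_lt hr]
    simp only [word]
    rw [hq, hm, if_neg (by omega)]
    congr 1 <;> omega

end LabelData

end PlanarReach

theorem mainTheorem6 :
    (∃ (P : PlanarReach.Program) (k c : ℕ),
      ∀ (V : Type u) (E : Type v) [Finite V] [Finite E] (G : PlanarReach.MultiDigraph V E) (h : ℕ),
        PlanarReach.AdmitsSTDecomposition.{u, v, t} G h →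
          ∃ label : V → List Bool,
            PlanarReach.IsReachabilityLabelling G P (k * PlanarReach.logSize V) label
              (c * (h + 1) * PlanarReach.logSize V) (c * (h + 1))) ∧
    (∀ h₀ : ℕ, ∃ (P : PlanarReach.Program) (k c : ℕ),
      ∀ (V : Type u) (E : Type v) [Finite V] [Finite E] (G : PlanarReach.MultiDigraph V E) (h : ℕ),
        h ≤ h₀ → PlanarReach.AdmitsSTDecomposition.{u, v, t} G h →
          ∃ label : V → List Bool,
            PlanarReach.IsReachabilityLabelling G P (k * PlanarReach.logSize V) label
              (c * PlanarReach.logSize V) c) := by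
  refine ⟨⟨PlanarReach.reachProgram, 7, 147, ?_⟩,
    fun h₀ => ⟨PlanarReach.reachProgram, 7, 147 * (h₀ + 1), ?_⟩⟩
  · intro V E _ _ G h hG
    obtain ⟨d⟩ := hG.nonempty_labelData
    exact ⟨_, d.isReachabilityLabelling (by omega)⟩
  · intro V E _ _ G h hh hG
    obtain ⟨d⟩ := hG.nonempty_labelData
    obtain ⟨h₁, h₂⟩ := d.isReachabilityLabelling (time := 147 * (h₀ + 1)) (by omega)
    refine ⟨_, fun x => (h₁ x).trans ?_, h₂⟩
    gcongr
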